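/- For $N\ge 1$ take $2N$ oriented triangles, triangle $i$ having its sides labelled $3i-2,3i-1,3i$ in their cyclic order, and let $\Omega_N$ be the set of partitions of the set $\{1,\dots,6N\}$ of sides into pairs, with the uniform probability measure $\mathbb{P}$. For $\omega\in\Omega_N$ let $S(\omega)$ be the closed oriented surface obtained by gluing the triangles along the paired sides, corners to corners and compatibly with the orientations. Let $g(\omega)$ be its genus (the sum of the genera of the components if $S(\omega)$ is disconnected). Let $\Gamma(\omega)$ be the dual cubic graph (a multigraph), embedded in $S(\omega)$ with one vertex at the centre of each triangle and one edge through the midpoint of each glued side. A circuit on $\Gamma(\omega)$ is a closed walk with at least one edge that repeats no vertex and no edge; loops and pairs of parallel edges count as circuits of one and two edges. If $g(\omega)>0$, let $m_{\ell,N}(\omega)$ be the smallest number of edges of a circuit on $\Gamma(\omega)$ that is not contractible on $S(\omega)$; if $g(\omega)=0$, put $m_{\ell,N}(\omega)=0$. Then for every $k\in\mathbb{N}$ the limit $\lim_{N\to\infty}\mathbb{P}(m_{\ell,N}=k)$ exists and $$\lim_{N\to\infty}\mathbb{P}(m_{\ell,N}=k)=\exp\Bigl(-\sum_{j=1}^{k-1}\frac{2^{j-1}-1}{j}\Bigr)-\exp\Bigl(-\sum_{j=1}^{k}\frac{2^{j-1}-1}{j}\Bigr),$$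 where empty sums are $0$ (so that both sides are $0$ for $k=0$ and $k=1$). -/

import Mathlib

open Filter Topology

noncomputable section

namespace RandomSurface

/-- The labels of the `6N` sides of `2N` triangles. The sides of the triangle `i` are
`(i, 0), (i, 1), (i, 2)`, in this cyclic order (so `(i, r)` stands for the label `3 i + r + 1`
when triangles are numbered from `0`). They are also the half-edges at the vertex `i` of the dual
cubic ribbon graph. -/
abbrev Side (N : ℕ) : Type := Fin (2 * N) × Fin 3

/-- The set `Ω_N` of partitions of the `6N` sides into pairs. A partition into pairs is the same
thing as the map that sends each element to the other element of its pair, that is, an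
involution without fixed points. -/
def Omega (N : ℕ) : Type :=
  {m : Side N → Side N // Function.Involutive m ∧ ∀ s, m s ≠ s}

variable {N : ℕ}

/-- The side with which the side `s` is paired. -/
def Omega.mate (ω : Omega N) (s : Side N) : Side N := ω.1 s

/-! ### The surface -/

/-- The standard triangle, with corners `e 0, e 1, e 2`. -/
abbrev Triangle : Type := stdSimplex ℝ (Fin 3)

/-- The corner `e r` of the triangle. -/
def corner (r : Fin 3) : Triangle := ⟨Pi.single r 1, single_mem_stdSimplex ℝ r⟩

/-- The point `(1 - t) x + t y` of the triangle. -/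
def seg (x y : Triangle) (t : unitInterval) : Triangle :=
  ⟨(1 - (t : ℝ)) • (x : Fin 3 → ℝ) + (t : ℝ) • (y : Fin 3 → ℝ),
    convex_stdSimplex ℝ (Fin 3) x.2 y.2 (sub_nonneg.2 t.2.2) t.2.1 (by ring)⟩

theorem continuous_seg (x y : Triangle) : Continuous (seg x y) := by
  unfold seg
  fun_prop

/-- The side `r` of the triangle, run through from the corner `e r` to the corner `e (r + 1)`.
The cyclic order of the sides is that of the boundary orientation. -/
def sidePoint (r : Fin 3) (t : unitInterval) : Triangle := seg (corner r) (corner (r + 1)) t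

/-- The elementary identifications of the gluing: a side is glued to its mate, corners to
corners, in the direction opposite to the boundary orientations (so that the orientations of the
triangles fit together). -/
inductive Glue (ω : Omega N) : Fin (2 * N) × Triangle → Fin (2 * N) × Triangle → Prop
  | side (s : Side N) (t : unitInterval) :
      Glue ω (s.1, sidePoint s.2 t)
        ((ω.mate s).1, sidePoint (ω.mate s).2 (unitInterval.symm t))

/-- The closed oriented surface glued from the `2N` triangles: the quotient space of their
disjoint union by the equivalence relation that the identifications generate. -/
def Surface (ω : Omega N) : Type := Quot (Glue ω)

instance (ω : Omega N) : TopologicalSpace (Surface ω) :=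
  inferInstanceAs (TopologicalSpace (Quot (Glue ω)))

/-- The point of the surface given by the point `x` of the triangle `i`. -/
def Surface.point (ω : Omega N) (i : Fin (2 * N)) (x : Triangle) : Surface ω :=
  Quot.mk (Glue ω) (i, x)

theorem Surface.continuous_point (ω : Omega N) (i : Fin (2 * N)) :
    Continuous (Surface.point ω i) :=
  continuous_quot_mk.comp (Continuous.prodMk_right i)

/-- The corners (vertices) of the triangulation of the surface. -/
def Surface.corners (ω : Omega N) : Set (Surface ω) :=
  Set.range fun c : Fin (2 * N) × Fin 3 => Surface.point ω c.1 (corner c.2)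

/-- The Euler characteristic: number of corners, minus the number `3N` of sides (after gluing),
plus the number `2N` of triangles. -/
def eulerChar (ω : Omega N) : ℤ := ((Surface.corners ω).ncard : ℤ) - 3 * N + 2 * N

/-- The genus `g` of the surface, given by `χ = 2 c - 2 g` where `c` is the number of connected
components (for a connected surface `χ = 2 - 2 g`; in general `g` is the sum of the genera of the
components). -/
def genus (ω : Omega N) : ℤ :=
  (2 * (Nat.card (ConnectedComponents (Surface ω)) : ℤ) - eulerChar ω) / 2

/-! ### The dual cubic graph and its embedding in the surface -/

/-- The midpoint of the triangle. -/
def barycenter : Triangle :=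
  ⟨fun _ => 1 / 3, fun _ => by norm_num, by norm_num [Fin.sum_univ_three]⟩

/-- The midpoint of the interval. -/
def half : unitInterval := ⟨1 / 2, by norm_num, by norm_num⟩

/-- The vertex of the graph that lies in the triangle `i`. -/
def vertexPoint (ω : Omega N) (i : Fin (2 * N)) : Surface ω := Surface.point ω i barycenter

/-- The point of the surface that is the midpoint of the side `s`. -/
def midPoint (ω : Omega N) (s : Side N) : Surface ω :=
  Surface.point ω s.1 (sidePoint s.2 half)

theorem midPoint_mate (ω : Omega N) (s : Side N) : midPoint ω s = midPoint ω (ω.mate s) := by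
  have h : unitInterval.symm half = half := by
    apply Subtype.ext
    norm_num [half]
  have := Quot.sound (Glue.side (ω := ω) s half)
  rwa [h] at this

/-- The half-edge `s`: the segment from the middle of the triangle to the midpoint of the side. -/
def halfEdge (ω : Omega N) (s : Side N) : Path (vertexPoint ω s.1) (midPoint ω s) where
  toFun t := Surface.point ω s.1 (seg barycenter (sidePoint s.2 half) t)
  continuous_toFun := (Surface.continuous_point ω s.1).comp (continuous_seg _ _)
  source' := by
    simp [vertexPoint, seg]
    rfl
  target' := by
    simp [midPoint, seg]
    rfl

/-- The edge of the graph made of the half-edges `s` and `ω.mate s`, traversed from the vertex of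
`s` to the vertex of `ω.mate s`. -/
def edgePath (ω : Omega N) (s : Side N) :
    Path (vertexPoint ω s.1) (vertexPoint ω (ω.mate s).1) :=
  (halfEdge ω s).trans ((halfEdge ω (ω.mate s)).symm.cast (midPoint_mate ω s) rfl)

/-- Walks on the cubic graph of `ω` from one vertex to another. A step from the vertex `u` leaves
along a half-edge `s` at `u` and arrives at the vertex of the half-edge paired with `s`. -/
inductive Walk (ω : Omega N) : Fin (2 * N) → Fin (2 * N) → Type
  | nil (u : Fin (2 * N)) : Walk ω u u
  | cons {u v : Fin (2 * N)} (s : Side N) (h : s.1 = u) (p : Walk ω (ω.mate s).1 v) : Walk ω u v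

namespace Walk

variable {ω : Omega N}

/-- The half-edges along which a walk leaves its successive vertices. -/
def darts : {u v : Fin (2 * N)} → Walk ω u v → List (Side N)
  | _, _, nil _ => []
  | _, _, cons s _ p => s :: p.darts

/-- The number of edges of a walk. -/
def length {u v : Fin (2 * N)} (p : Walk ω u v) : ℕ := p.darts.length

/-- The curve on the surface that a walk runs through. -/
def toPath : {u v : Fin (2 * N)} → Walk ω u v → Path (vertexPoint ω u) (vertexPoint ω v)
  | _, _, nil _ => Path.refl _
  | _, _, cons s h p => ((edgePath ω s).trans p.toPath).cast (by rw [h]) rfl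

/-- A closed walk is a circuit if it has at least one edge, visits no vertex twice and runs through
no edge twice (the last condition only excludes going to and fro on one edge). Loops and pairs of
parallel edges are circuits, with one and two edges. -/
def IsCircuit {u : Fin (2 * N)} (p : Walk ω u u) : Prop :=
  p.darts ≠ [] ∧ (p.darts.map Prod.fst).Nodup ∧ ∀ s ∈ p.darts, ω.mate s ∉ p.darts

/-- A closed walk is contractible if the closed curve that it runs through is null-homotopic on
the closed surface. -/
def IsContractible {u : Fin (2 * N)} (p : Walk ω u u) : Prop :=
  p.toPath.Homotopic (Path.refl (vertexPoint ω u))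

end Walk

/-- `m_ℓ`: the smallest number of edges of a circuit on the graph of `ω` that is not contractible
on the closed surface if the genus is positive (then there is such a circuit), and `0`
otherwise. -/
def mEll (ω : Omega N) : ℕ :=
  open Classical in
  if 0 < genus ω then
    sInf {k : ℕ | ∃ (u : Fin (2 * N)) (p : Walk ω u u),
      p.IsCircuit ∧ ¬ p.IsContractible ∧ p.length = k}
  else 0

/-- The probability of an event in the finite set `Ω_N` with the uniform distribution. -/
def prob (N : ℕ) (A : Set (Omega N)) : ℝ := (Nat.card A : ℝ) / (Nat.card (Omega N) : ℝ)

end RandomSurface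

end

/-!
Call a circuit *mixed* if it makes a left turn at some vertex and a right turn at another one.

*Circuits that are not mixed.* A circuit that always turns to the same side goes around a corner of
the triangulation. Each of its edges can be pushed over the side that it crosses, into that corner;
the pushed edges cancel one after another, so that the circuit is contractible
(`Pattern.Occurs.isContractible`).

*Mixed circuits.* An integral circulation on the graph is an integral simplicial cocycle of the
triangulation. It gives a map of the surface to `ℝ / ℤ` that is affine on every triangle, and
because `ℝ → ℝ / ℤ` is a covering, a contractible circuit has variation zero along this map
(`IsFlow.sum_rise_eq_zero`). The variation is the intersection number of the circuit with the
circulation (`Pattern.Occurs.sum_rise`). If the two sides of a mixed circuit were connected off the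
circuit, some closed walk would cross it exactly once. A contractible mixed circuit with at most `k`
edges therefore separates, and together with the smaller of its sides it gives a *tight set*: at
most `N + k` vertices, with at most `k` outgoing half-edges and fewer of them than vertices
(`Pattern.Occurs.exists_cut_lt_card`).

*Tight sets are rare.* A given set of `2 m` sides is a union of pairs with probability at most
`1 / (3N choose m)`, and `(2N choose n) (N choose q) ≤ (3N choose n + q)`. The expected number of
sets of `n = b + 2 q` vertices with `b` outgoing half-edges is thus at most
`(3n choose b) / (N choose q)`. Summing over `q ≥ 1` gives `O(1 / N)` for the tight sets
(`exists_expect_tightSets_le`); the terms with `q = 0` give a bounded expectation for the small sets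
with at most as many outgoing half-edges as vertices (`exists_expect_cyclicSets_le`). The triangles
around a corner of small degree form a set of the latter kind, so that with high probability there
are at most `N` corners and the genus is positive (`tendsto_prob_genus_nonpos`).

*Poisson approximation.* Two distinct circuits that meet part at a vertex all of whose three
half-edges they use; hence a family of distinct short circuits that are not all disjoint spans a
tight set. The factorial moments of the number of mixed circuits with at most `k` edges are
therefore asymptotically given by the disjoint families, and they converge to the powers of
`∑ (2 ^ (j - 1) - 1) / j`, since there are `(2N)_j (6 ^ j / 2 - 3 ^ j) / j` possible mixed circuits
with `j` edges, each present with probability about `(6N) ^ (-j)`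
(`Circ.tendsto_expect_descFactorial_count`). By Bonferroni's inequalities the probability that there
is no such circuit converges to the exponential in question (`tendsto_prob_count_eq_zero`).

Off an event of vanishing probability, `mEll ω = k` for `k ≥ 1` means that there is a mixed circuit
with at most `k` edges but none with at most `k - 1`, and `mEll ω = 0` means that there is no mixed
circuit of any bounded length (`mEll_eq_iff`, `count_eq_zero_of_mEll_eq_zero`).
-/

noncomputable section

namespace RandomSurface

variable {N : ℕ}

/-! ### Variation of a map to the circle along a path -/

/-- `HasVariation F γ d` says that the function `F ∘ γ` to the circle `ℝ / ℤ` has a continuous lift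
to `ℝ` that grows by `d` in total. -/
def HasVariation {X : Type*} [TopologicalSpace X] (F : C(X, UnitAddCircle)) {x y : X}
    (γ : Path x y) (d : ℝ) : Prop :=
  ∃ Γ : C(unitInterval, ℝ), (∀ t, (Γ t : UnitAddCircle) = F (γ t)) ∧ Γ 1 - Γ 0 = d

namespace HasVariation

variable {X : Type*} [TopologicalSpace X] {F : C(X, UnitAddCircle)} {x y z : X}

theorem symm {γ : Path x y} {d : ℝ} (h : HasVariation F γ d) : HasVariation F γ.symm (-d) := by
  obtain ⟨Γ, h1, h2⟩ := h
  refine ⟨Γ.comp ⟨unitInterval.symm, unitInterval.continuous_symm⟩, fun t => ?_, ?_⟩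
  · simpa using h1 (unitInterval.symm t)
  · simp [← h2]

theorem cast {γ : Path x y} {d : ℝ} (h : HasVariation F γ d) {x' y' : X} (hx : x' = x)
    (hy : y' = y) : HasVariation F (γ.cast hx hy) d := by
  subst hx hy; exact h

theorem refl (x : X) : HasVariation F (Path.refl x) 0 := by
  obtain ⟨r, hr⟩ := QuotientAddGroup.mk_surjective (F x)
  exact ⟨.const _ r, fun t => hr, by simp⟩

theorem trans {γ : Path x y} {γ' : Path y z} {d d' : ℝ} (h : HasVariation F γ d)
    (h' : HasVariation F γ' d') : HasVariation F (γ.trans γ') (d + d') := by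
  obtain ⟨Γ, h1, rfl⟩ := h
  obtain ⟨Γ', h1', rfl⟩ := h'
  -- the two lifts may differ by an integer over the common point `y`
  have hc : ((Γ' 0 - Γ 1 : ℝ) : UnitAddCircle) = 0 := by
    rw [AddCircle.coe_sub, h1, h1']; simp
  let P : Path (Γ 0) (Γ 1) := ⟨Γ, rfl, rfl⟩
  let P' : Path (Γ 1) (Γ' 1 - (Γ' 0 - Γ 1)) :=
    ⟨⟨fun t => Γ' t - (Γ' 0 - Γ 1), by fun_prop⟩, by simp, by simp⟩
  refine ⟨(P.trans P').toContinuousMap, fun t => ?_, ?_⟩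
  · change ((P.trans P' t : ℝ) : UnitAddCircle) = F (γ.trans γ' t)
    rw [Path.trans_apply, Path.trans_apply]
    split_ifs
    · exact h1 _
    · change ((Γ' _ - (Γ' 0 - Γ 1) : ℝ) : UnitAddCircle) = _
      rw [AddCircle.coe_sub, hc, h1', sub_zero]
  · have e1 : (P.trans P').toContinuousMap 1 = _ := (P.trans P').target
    have e0 : (P.trans P').toContinuousMap 0 = _ := (P.trans P').source
    rw [e1, e0]; ring

/-- A null-homotopic loop has variation zero, because `ℝ → ℝ / ℤ` is a covering map. -/
theorem eq_zero_of_homotopic_refl {γ : Path x x} {d : ℝ} (h : HasVariation F γ d)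
    (hγ : γ.Homotopic (Path.refl x)) : d = 0 := by
  obtain ⟨Γ, h1, rfl⟩ := h
  have cov := AddCircle.isCoveringMap_coe (1 : ℝ)
  have h0 : F x = ((Γ 0 : ℝ) : UnitAddCircle) := by rw [h1]; simp
  have key := cov.liftPath_apply_one_eq_of_homotopicRel (hγ.map F) (Γ 0) (by simpa using h0)
    (by simpa using h0)
  have e1 : Γ = cov.liftPath (γ.map F.continuous).toContinuousMap (Γ 0) (by simpa using h0) := by
    rw [cov.eq_liftPath_iff']
    exact ⟨funext h1, rfl⟩
  have e2 : ContinuousMap.const _ (Γ 0) =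
      cov.liftPath ((Path.refl x).map F.continuous).toContinuousMap (Γ 0) (by simpa using h0) := by
    rw [cov.eq_liftPath_iff']
    exact ⟨funext fun t => by simp [h0], rfl⟩
  rw [← e1, ← e2] at key
  simpa [sub_eq_zero] using key

end HasVariation

/-! ### Circulations and maps of the surface to the circle -/

theorem Omega.mate_mate (ω : Omega N) (s : Side N) : ω.mate (ω.mate s) = s := ω.2.1 s

theorem Omega.mate_ne (ω : Omega N) (s : Side N) : ω.mate s ≠ s := ω.2.2 s

theorem Omega.mate_injective (ω : Omega N) : Function.Injective ω.mate := ω.2.1.injective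

/-- An integral circulation on the dual graph, given by its values on darts. On the triangulated
surface the same data is an integral simplicial cocycle. -/
structure IsFlow (ω : Omega N) (a : Side N → ℤ) : Prop where
  mate : ∀ s, a (ω.mate s) = -a s
  sum_eq_zero : ∀ i, a (i, 0) + a (i, 1) + a (i, 2) = 0

theorem seg_apply (x y : Triangle) (t : unitInterval) (r : Fin 3) :
    seg x y t r = (1 - t) * x r + t * y r := rfl

theorem corner_apply (r r' : Fin 3) : corner r r' = if r' = r then 1 else 0 := by
  change (Pi.single r 1 : Fin 3 → ℝ) r' = _
  rw [Pi.single_apply]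

theorem barycenter_apply (r : Fin 3) : barycenter r = 1 / 3 := rfl

/-- The affine function on the triangle `i` that is `0` at the corner `e 0` and grows by `a (i, r)`
along the side `r`. -/
def height (a : Side N → ℤ) (i : Fin (2 * N)) (x : Triangle) : ℝ :=
  x 1 * a (i, 0) - x 2 * a (i, 2)

theorem continuous_height (a : Side N → ℤ) (i : Fin (2 * N)) : Continuous (height a i) := by
  have h (r : Fin 3) : Continuous fun x : Triangle => x r :=
    (continuous_apply r).comp continuous_subtype_val
  exact ((h 1).mul continuous_const).sub ((h 2).mul continuous_const)

/-- The growth of the height function along the half-edge `s` from the middle of the triangle to the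
midpoint of the side, for a circulation `a`. -/
def rise (a : Side N → ℤ) (s : Side N) : ℝ := (a (s.1, s.2 + 2) - a (s.1, s.2 + 1)) / 6

namespace IsFlow

variable {ω : Omega N} {a : Side N → ℤ}

/-- On the side `r` the height function agrees modulo `1` with the linear function of slope
`a (i, r)`; this is what makes it compatible with the gluing. -/
theorem height_sidePoint (ha : IsFlow ω a) (i : Fin (2 * N)) (r : Fin 3) (t : unitInterval) :
    ∃ n : ℤ, height a i (sidePoint r t) = n + t * a (i, r) := by
  have h : (a (i, 0) + a (i, 1) + a (i, 2) : ℝ) = 0 := by exact_mod_cast ha.sum_eq_zero i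
  fin_cases r
  · refine ⟨0, ?_⟩
    simp [height, sidePoint, seg_apply, corner_apply]
  · refine ⟨a (i, 0), ?_⟩
    simp [height, sidePoint, seg_apply, corner_apply]
    linear_combination (-(t : ℝ)) * h
  · refine ⟨-a (i, 2), ?_⟩
    simp [height, sidePoint, seg_apply, corner_apply]
    ring

/-- The map from the surface to the circle `ℝ / ℤ` that represents the cocycle `a`: all corners go
to `0`, and the map is affine on each triangle. -/
def circleMap (ha : IsFlow ω a) : C(Surface ω, UnitAddCircle) where
  toFun := Quot.lift (fun p : Fin (2 * N) × Triangle => (height a p.1 p.2 : UnitAddCircle)) (by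
    rintro _ _ ⟨s, t⟩
    obtain ⟨n, hn⟩ := ha.height_sidePoint s.1 s.2 t
    obtain ⟨n', hn'⟩ := ha.height_sidePoint (ω.mate s).1 (ω.mate s).2 (unitInterval.symm t)
    have hm : (a (ω.mate s) : ℝ) = -a s := by exact_mod_cast ha.mate s
    change ((height a s.1 (sidePoint s.2 t) : ℝ) : UnitAddCircle) =
      ((height a (ω.mate s).1 (sidePoint (ω.mate s).2 (unitInterval.symm t)) : ℝ) : UnitAddCircle)
    rw [hn, hn', ← sub_eq_zero, ← AddCircle.coe_sub, AddCircle.coe_eq_zero_iff]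
    refine ⟨n - n' + a s, ?_⟩
    simp only [Prod.mk.eta, hm, unitInterval.coe_symm_eq]
    simp
    ring)
  continuous_toFun := by
    refine continuous_quot_lift _ ?_
    have : Continuous fun p : Fin (2 * N) × Triangle => height a p.1 p.2 :=
      continuous_prod_of_discrete_left.2 fun i => continuous_height a i
    exact (AddCircle.continuous_mk' (1 : ℝ)).comp this

theorem hasVariation_halfEdge (ha : IsFlow ω a) (s : Side N) :
    HasVariation ha.circleMap (halfEdge ω s) (rise a s) := by
  refine ⟨⟨fun t => height a s.1 (seg barycenter (sidePoint s.2 half) t),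
    (continuous_height a s.1).comp (continuous_seg _ _)⟩, fun t => rfl, ?_⟩
  obtain ⟨i, r⟩ := s
  have h : (a (i, 0) + a (i, 1) + a (i, 2) : ℝ) = 0 := by exact_mod_cast ha.sum_eq_zero i
  fin_cases r <;>
    simp [height, sidePoint, seg_apply, corner_apply, rise, half, barycenter_apply]
  · linear_combination (1 / 6 : ℝ) * h
  · ring
  · linear_combination (-1 / 6 : ℝ) * h

theorem hasVariation_edgePath (ha : IsFlow ω a) (s : Side N) :
    HasVariation ha.circleMap (edgePath ω s) (rise a s - rise a (ω.mate s)) := by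
  rw [sub_eq_add_neg]
  exact (ha.hasVariation_halfEdge s).trans ((ha.hasVariation_halfEdge (ω.mate s)).symm.cast _ _)

theorem hasVariation_toPath (ha : IsFlow ω a) {u v : Fin (2 * N)} (p : Walk ω u v) :
    HasVariation ha.circleMap p.toPath
      (p.darts.map fun s => rise a s - rise a (ω.mate s)).sum := by
  induction p with
  | nil u => exact HasVariation.refl _
  | cons s h p ih =>
    simp only [Walk.darts, List.map_cons, List.sum_cons]
    exact ((ha.hasVariation_edgePath s).trans ih).cast _ _

theorem sum_rise_eq_zero (ha : IsFlow ω a) {u : Fin (2 * N)} {p : Walk ω u u}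
    (hp : p.IsContractible) :
    (p.darts.map fun s => rise a s - rise a (ω.mate s)).sum = 0 :=
  (ha.hasVariation_toPath p).eq_zero_of_homotopic_refl hp

end IsFlow

/-! ### Patterns of circuits -/

/-- The number of half-edges at the vertices in `A` whose edge leaves `A`. -/
def cut (ω : Omega N) (A : Finset (Fin (2 * N))) : ℕ :=
  (Finset.univ.filter fun s : Side N => s.1 ∈ A ∧ (ω.mate s).1 ∉ A).card

/-- A pattern for an oriented rooted circuit with `n + 1` edges: the distinct vertices in their
cyclic order, the index of the half-edge along which each vertex is left, and the direction of the
turn made there. The turn is `true` if the half-edge along which the vertex is left follows the one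
along which it is entered, in the cyclic order of the triangle, and `false` if it precedes it. -/
@[ext]
structure Pattern (N n : ℕ) where
  vertex : Fin (n + 1) → Fin (2 * N)
  out : Fin (n + 1) → Fin 3
  turn : Fin (n + 1) → Bool
  vertex_injective : Function.Injective vertex

namespace Pattern

variable {n : ℕ}

/-- The index of the half-edge along which the vertex `i` is entered. -/
def inn (c : Pattern N n) (i : Fin (n + 1)) : Fin 3 := c.out i + if c.turn i then 2 else 1

/-- The index of the half-edge at the vertex `i` that the circuit does not use. -/
def third (c : Pattern N n) (i : Fin (n + 1)) : Fin 3 := c.out i + if c.turn i then 1 else 2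

/-- The half-edge along which the vertex `i` is left. -/
def outSide (c : Pattern N n) (i : Fin (n + 1)) : Side N := (c.vertex i, c.out i)

/-- The half-edge along which the vertex `i` is entered. -/
def innSide (c : Pattern N n) (i : Fin (n + 1)) : Side N := (c.vertex i, c.inn i)

/-- The half-edge at the vertex `i` that does not belong to the circuit. -/
def thirdSide (c : Pattern N n) (i : Fin (n + 1)) : Side N := (c.vertex i, c.third i)

/-- The circuit described by the pattern is present in the graph of `ω`. -/
def Occurs (ω : Omega N) (c : Pattern N n) : Prop :=
  ∀ i, ω.mate (c.outSide i) = c.innSide (i + 1)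

theorem inn_ne_out (c : Pattern N n) (i : Fin (n + 1)) : c.inn i ≠ c.out i := by
  unfold inn
  generalize c.out i = r
  cases c.turn i <;> revert r <;> decide

theorem third_ne_out (c : Pattern N n) (i : Fin (n + 1)) : c.third i ≠ c.out i := by
  unfold third
  generalize c.out i = r
  cases c.turn i <;> revert r <;> decide

theorem third_ne_inn (c : Pattern N n) (i : Fin (n + 1)) : c.third i ≠ c.inn i := by
  unfold third inn
  generalize c.out i = r
  cases c.turn i <;> revert r <;> decide

theorem eq_out_or_inn_or_third (c : Pattern N n) (i : Fin (n + 1)) (r : Fin 3) :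
    r = c.out i ∨ r = c.inn i ∨ r = c.third i := by
  unfold third inn
  generalize c.out i = r'
  cases c.turn i <;> revert r r' <;> decide

variable {ω : Omega N} {c : Pattern N n}

theorem thirdSide_ne_outSide (i i' : Fin (n + 1)) : c.thirdSide i ≠ c.outSide i' := by
  intro h
  have h1 := c.vertex_injective (congrArg Prod.fst h)
  subst h1
  exact c.third_ne_out i (congrArg Prod.snd h)

theorem thirdSide_ne_innSide (i i' : Fin (n + 1)) : c.thirdSide i ≠ c.innSide i' := by
  intro h
  have h1 := c.vertex_injective (congrArg Prod.fst h)
  subst h1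
  exact c.third_ne_inn i (congrArg Prod.snd h)

theorem thirdSide_injective (c : Pattern N n) : Function.Injective c.thirdSide := fun _ _ h =>
  c.vertex_injective (congrArg Prod.fst h)

theorem Occurs.mate_innSide (h : Occurs ω c) (i : Fin (n + 1)) :
    ω.mate (c.innSide i) = c.outSide (i - 1) := by
  have := h (i - 1)
  rw [sub_add_cancel] at this
  rw [← this, ω.mate_mate]

end Pattern

/-! ### A null-homologous mixed circuit separates -/

/-- An integral flow of value one from `u` to `v` on the dual graph. -/
structure IsFlowFromTo (ω : Omega N) (a : Side N → ℤ) (u v : Fin (2 * N)) : Prop where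
  mate : ∀ s, a (ω.mate s) = -a s
  sum_eq : ∀ i, a (i, 0) + a (i, 1) + a (i, 2) =
    (if i = u then 1 else 0) - if i = v then 1 else 0

namespace IsFlowFromTo

variable {ω : Omega N} {a b : Side N → ℤ} {u v w : Fin (2 * N)}

theorem refl (ω : Omega N) (u : Fin (2 * N)) : IsFlowFromTo ω 0 u u :=
  ⟨by simp, by simp⟩

theorem add (ha : IsFlowFromTo ω a u v) (hb : IsFlowFromTo ω b v w) :
    IsFlowFromTo ω (a + b) u w := by
  refine ⟨fun s => by simp [ha.mate s, hb.mate s]; ring, fun i => ?_⟩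
  have h1 := ha.sum_eq i
  have h2 := hb.sum_eq i
  simp only [Pi.add_apply]
  linear_combination h1 + h2

theorem neg (ha : IsFlowFromTo ω a u v) : IsFlowFromTo ω (-a) v u := by
  refine ⟨fun s => by simp [ha.mate s], fun i => ?_⟩
  simp only [Pi.neg_apply]
  linear_combination -(ha.sum_eq i)

theorem isFlow (ha : IsFlowFromTo ω a u u) : IsFlow ω a :=
  ⟨ha.mate, fun i => by rw [ha.sum_eq i, sub_self]⟩

/-- The unit flow along the dart `s`. -/
theorem single (ω : Omega N) (s : Side N) :
    IsFlowFromTo ω (Pi.single s 1 - Pi.single (ω.mate s) 1) s.1 (ω.mate s).1 := by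
  have key (t : Side N) (i : Fin (2 * N)) : (Pi.single t 1 : Side N → ℤ) (i, 0) +
      (Pi.single t 1 : Side N → ℤ) (i, 1) + (Pi.single t 1 : Side N → ℤ) (i, 2) =
      if i = t.1 then 1 else 0 := by
    obtain ⟨j, r⟩ := t
    fin_cases r <;> simp [Pi.single_apply]
  refine ⟨fun t => ?_, fun i => ?_⟩
  · have h1 : ω.mate t = s ↔ t = ω.mate s :=
      ⟨fun h => by rw [← h, ω.mate_mate], fun h => by rw [h, ω.mate_mate]⟩
    have h2 : ω.mate t = ω.mate s ↔ t = s := ω.mate_injective.eq_iff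
    simp [Pi.single_apply, h1, h2]
  · rw [← key s, ← key (ω.mate s)]
    simp only [Pi.sub_apply]
    ring

end IsFlowFromTo

namespace Pattern

variable {n : ℕ} {ω : Omega N} {c : Pattern N n}

/-- One step in the graph along an edge that belongs to the circuit or avoids all its vertices. -/
def Step (ω : Omega N) (c : Pattern N n) (u v : Fin (2 * N)) : Prop :=
  ∃ s : Side N, s.1 = u ∧ (ω.mate s).1 = v ∧ (∀ i, s ≠ c.thirdSide i) ∧
    ∀ i, ω.mate s ≠ c.thirdSide i

/-- Connected vertices are joined by a flow that does not use the third half-edges. -/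
theorem exists_flow_of_reflTransGen {u v : Fin (2 * N)} (h : Relation.ReflTransGen (Step ω c) u v) :
    ∃ a, IsFlowFromTo ω a u v ∧ ∀ i, a (c.thirdSide i) = 0 := by
  induction h with
  | refl => exact ⟨0, .refl ω u, fun i => rfl⟩
  | tail _ hs ih =>
    obtain ⟨a, ha, ha0⟩ := ih
    obtain ⟨s, rfl, rfl, h1, h2⟩ := hs
    refine ⟨_, ha.add (.single ω s), fun i => ?_⟩
    simp [ha0, (h1 i).symm, (h2 i).symm]

theorem Occurs.step_vertex (h : Occurs ω c) (i : Fin (n + 1)) :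
    Step ω c (c.vertex i) (c.vertex (i + 1)) :=
  ⟨c.outSide i, rfl, by rw [h]; rfl, fun i' => (thirdSide_ne_outSide i' i).symm,
    fun i' => by rw [h]; exact (thirdSide_ne_innSide i' _).symm⟩

theorem Occurs.reflTransGen_vertex (h : Occurs ω c) (i i' : Fin (n + 1)) :
    Relation.ReflTransGen (Step ω c) (c.vertex i) (c.vertex i') := by
  have key (m : ℕ) : Relation.ReflTransGen (Step ω c) (c.vertex i)
      (c.vertex (i + Fin.ofNat (n + 1) m)) := by
    induction m with
    | zero => simpa using Relation.ReflTransGen.refl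
    | succ m ih =>
      have := ih.tail (h.step_vertex _)
      convert this using 2
      rw [add_assoc]
      congr 1
      apply Fin.ext
      simp [Fin.val_add]
  have h1 := key (i' - i).val
  have h2 : i + Fin.ofNat (n + 1) (i' - i).val = i' := by
    have : Fin.ofNat (n + 1) (i' - i).val = i' - i := Fin.ext (Nat.mod_eq_of_lt (i' - i).isLt)
    rw [this]; abel
  rwa [h2] at h1

/-- The set of vertices of the circuit. -/
def vertices (c : Pattern N n) : Finset (Fin (2 * N)) := Finset.univ.image c.vertex

theorem mem_vertices {x : Fin (2 * N)} : x ∈ c.vertices ↔ ∃ i, c.vertex i = x := by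
  simp [vertices]

theorem vertex_mem (c : Pattern N n) (i : Fin (n + 1)) : c.vertex i ∈ c.vertices :=
  mem_vertices.2 ⟨i, rfl⟩

theorem card_vertices (c : Pattern N n) : c.vertices.card = n + 1 := by
  rw [vertices, Finset.card_image_of_injective _ c.vertex_injective]
  simp

/-- A half-edge at the circuit that is not a third one belongs to an edge of the circuit. -/
theorem Occurs.mate_mem {s : Side N} (h : Occurs ω c) (hs : s.1 ∈ c.vertices)
    (hs' : ∀ i, s ≠ c.thirdSide i) :
    (ω.mate s).1 ∈ c.vertices ∧ ∀ i, ω.mate s ≠ c.thirdSide i := by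
  obtain ⟨i, hi⟩ := mem_vertices.1 hs
  obtain ⟨x, r⟩ := s
  change c.vertex i = x at hi
  subst hi
  rcases c.eq_out_or_inn_or_third i r with rfl | rfl | rfl
  · change (ω.mate (c.outSide i)).1 ∈ _ ∧ ∀ i', ω.mate (c.outSide i) ≠ _
    rw [h]
    exact ⟨vertex_mem _ _, fun i' => (thirdSide_ne_innSide i' _).symm⟩
  · change (ω.mate (c.innSide i)).1 ∈ _ ∧ ∀ i', ω.mate (c.innSide i) ≠ _
    rw [h.mate_innSide]
    exact ⟨vertex_mem _ _, fun i' => (thirdSide_ne_outSide i' _).symm⟩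
  · exact absurd rfl (hs' i)

/-- The vertices off the circuit that can be reached from it when it is left at a turn of the given
kind and not met again. -/
def reach (ω : Omega N) (c : Pattern N n) (b : Bool) : Finset (Fin (2 * N)) :=
  open Classical in
  Finset.univ.filter fun x => ∃ i, c.turn i = b ∧
    (∀ i', ω.mate (c.thirdSide i) ≠ c.thirdSide i') ∧
    Relation.ReflTransGen (Step ω c) (ω.mate (c.thirdSide i)).1 x

theorem mem_reach {b : Bool} {x : Fin (2 * N)} : x ∈ reach ω c b ↔ ∃ i, c.turn i = b ∧
    (∀ i', ω.mate (c.thirdSide i) ≠ c.thirdSide i') ∧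
    Relation.ReflTransGen (Step ω c) (ω.mate (c.thirdSide i)).1 x := by
  simp [reach]

theorem Occurs.disjoint_vertices_reach (h : Occurs ω c) (b : Bool) :
    Disjoint c.vertices (reach ω c b) := by
  rw [Finset.disjoint_right]
  intro x hx
  obtain ⟨i, hb, hi, hr⟩ := mem_reach.1 hx
  induction hr with
  | refl =>
    intro hv
    have := (h.mate_mem hv hi).2 i
    rw [ω.mate_mate] at this
    exact this rfl
  | tail hr hs ih =>
    intro hv
    obtain ⟨s, rfl, rfl, h1, h2⟩ := hs
    have := (h.mate_mem hv h2).1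
    rw [ω.mate_mate] at this
    exact ih (mem_reach.2 ⟨i, hb, hi, hr⟩) this

/-- All edges that leave the union of the circuit and one of its sides start at a turn of the other
kind. -/
theorem Occurs.cut_union_reach_le (h : Occurs ω c) {b : Bool} {i₀ : Fin (n + 1)}
    (hb : c.turn i₀ = b) : cut ω (c.vertices ∪ reach ω c b) ≤ n := by
  classical
  have hsub : (Finset.univ.filter fun s : Side N => s.1 ∈ c.vertices ∪ reach ω c b ∧
      (ω.mate s).1 ∉ c.vertices ∪ reach ω c b) ⊆ (Finset.univ.erase i₀).image c.thirdSide := by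
    intro s hs
    simp only [Finset.mem_filter, Finset.mem_univ, true_and, Finset.mem_union, not_or] at hs
    obtain ⟨hs1, hs2, hs3⟩ := hs
    rcases hs1 with hs1 | hs1
    · by_cases ht : ∀ i, s ≠ c.thirdSide i
      · exact absurd (h.mate_mem hs1 ht).1 hs2
      · push Not at ht
        obtain ⟨i, rfl⟩ := ht
        refine Finset.mem_image_of_mem _ (Finset.mem_erase.2 ⟨?_, Finset.mem_univ _⟩)
        rintro rfl
        refine hs3 (mem_reach.2 ⟨i, hb, fun i' hi' => ?_, .refl⟩)
        rw [hi'] at hs2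
        exact hs2 (vertex_mem _ _)
    · exfalso
      have hsv : s.1 ∉ c.vertices := Finset.disjoint_right.1 (h.disjoint_vertices_reach b) hs1
      obtain ⟨i, hi1, hi2, hi3⟩ := mem_reach.1 hs1
      refine hs3 (mem_reach.2 ⟨i, hi1, hi2,
        hi3.tail ⟨s, rfl, rfl, fun i' hi' => ?_, fun i' hi' => ?_⟩⟩)
      · rw [hi'] at hsv
        exact hsv (vertex_mem _ _)
      · rw [hi'] at hs2
        exact hs2 (vertex_mem _ _)
  calc cut ω (c.vertices ∪ reach ω c b) ≤ _ := Finset.card_le_card hsub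
    _ ≤ _ := Finset.card_image_le
    _ = n := by simp

/-- The growth of the height function along the part of a circuit in one triangle is half of the
flow through the third half-edge, with the sign given by the direction of the turn. -/
theorem rise_sub_rise {a : Side N → ℤ} (ha : IsFlow ω a) (i : Fin (n + 1)) :
    rise a (c.outSide i) - rise a (c.innSide i) =
      if c.turn i then -(a (c.thirdSide i) : ℝ) / 2 else a (c.thirdSide i) / 2 := by
  have h : (a (c.vertex i, 0) + a (c.vertex i, 1) + a (c.vertex i, 2) : ℝ) = 0 := by
    exact_mod_cast ha.sum_eq_zero (c.vertex i)
  simp only [rise, outSide, innSide, thirdSide, inn, third]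
  generalize c.vertex i = x at h
  generalize c.out i = r
  have e1 : (1 + 1 : Fin 3) = 2 := rfl
  have e2 : (1 + 2 : Fin 3) = 0 := rfl
  have e3 : (2 + 1 : Fin 3) = 0 := rfl
  have e4 : (2 + 2 : Fin 3) = 1 := rfl
  cases c.turn i <;> fin_cases r <;> simp [e1, e2, e3, e4] <;> grind

/-- The variation along a circuit is half of the net flow across it, that is, the intersection
number of the circuit with the circulation. -/
theorem Occurs.sum_rise (h : Occurs ω c) {a : Side N → ℤ} (ha : IsFlow ω a) :
    ∑ i, (rise a (c.outSide i) - rise a (ω.mate (c.outSide i))) =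
      ∑ i, if c.turn i then -(a (c.thirdSide i) : ℝ) / 2 else a (c.thirdSide i) / 2 := by
  simp_rw [← rise_sub_rise ha, Finset.sum_sub_distrib, h _]
  congr 1
  exact Equiv.sum_comp (Equiv.addRight 1) fun i => rise a (c.innSide i)

/-- If the two sides of the circuit were connected off the circuit, there would be a closed walk
that crosses the circuit exactly once. -/
theorem Occurs.disjoint_reach (h : Occurs ω c)
    (h0 : ∀ a, IsFlow ω a → ∑ i, (rise a (c.outSide i) - rise a (ω.mate (c.outSide i))) = 0) :
    Disjoint (reach ω c true) (reach ω c false) := by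
  rw [Finset.disjoint_left]
  intro x hx hx'
  obtain ⟨i, hi, hT, hr⟩ := mem_reach.1 hx
  obtain ⟨i', hi', hT', hr'⟩ := mem_reach.1 hx'
  obtain ⟨a, ha, ha0⟩ := exists_flow_of_reflTransGen hr
  obtain ⟨a', ha', ha0'⟩ := exists_flow_of_reflTransGen hr'
  obtain ⟨b, hb, hb0⟩ := exists_flow_of_reflTransGen (h.reflTransGen_vertex i' i)
  -- leave the circuit to one side, return to it from the other side, and close up along the circuit
  have hf := ((IsFlowFromTo.single ω (c.thirdSide i)).add (ha.add (ha'.neg.add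
    ((IsFlowFromTo.single ω (c.thirdSide i')).neg.add hb)))).isFlow
  have key := h0 _ hf
  rw [h.sum_rise hf] at key
  have hne : i' ≠ i := by rintro rfl; simp [hi] at hi'
  have hv (m : Fin (n + 1)) : (Pi.single (c.thirdSide i) 1 - Pi.single (ω.mate (c.thirdSide i)) 1 +
      (a + (-a' + (-(Pi.single (c.thirdSide i') 1 - Pi.single (ω.mate (c.thirdSide i')) 1) + b))) :
      Side N → ℤ) (c.thirdSide m) = (if m = i then 1 else 0) - if m = i' then 1 else 0 := by
    simp [Pi.single_apply, ha0, ha0', hb0, (hT m).symm, (hT' m).symm, c.thirdSide_injective.eq_iff]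
    ring
  simp_rw [hv] at key
  have hterm (m : Fin (n + 1)) : (if c.turn m then
      -((((if m = i then 1 else 0) - if m = i' then 1 else 0 : ℤ)) : ℝ) / 2 else
      (((if m = i then 1 else 0) - if m = i' then 1 else 0 : ℤ) : ℝ) / 2) =
      (if m = i then -1 / 2 else 0) + if m = i' then -1 / 2 else 0 := by
    by_cases h1 : m = i
    · subst h1; simp [hi, hne.symm]
    · by_cases h2 : m = i'
      · subst h2; simp [hi', h1]
      · simp [h1, h2]
  simp_rw [hterm, Finset.sum_add_distrib, Finset.sum_ite_eq', Finset.mem_univ, if_true] at key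
  norm_num at key

/-- A circuit with turns of both kinds that is null-homologous (all flows have intersection number
zero with it) separates, so that on one of its sides it bounds a set of at most half of the vertices
that has few outgoing edges. -/
theorem Occurs.exists_cut_lt_card (h : Occurs ω c) {i i' : Fin (n + 1)} (hi : c.turn i = true)
    (hi' : c.turn i' = false)
    (h0 : ∀ a, IsFlow ω a → ∑ i, (rise a (c.outSide i) - rise a (ω.mate (c.outSide i))) = 0) :
    ∃ A : Finset (Fin (2 * N)), 2 * A.card ≤ 2 * N + (n + 1) ∧ cut ω A < A.card ∧ cut ω A ≤ n := by
  have hcard (b : Bool) : (c.vertices ∪ reach ω c b).card = (n + 1) + (reach ω c b).card := by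
    rw [Finset.card_union_of_disjoint (h.disjoint_vertices_reach b), card_vertices]
  have hle : (n + 1) + (reach ω c true).card + (reach ω c false).card ≤ 2 * N := by
    have hd : Disjoint (c.vertices ∪ reach ω c true) (reach ω c false) :=
      Finset.disjoint_union_left.2 ⟨h.disjoint_vertices_reach _, h.disjoint_reach h0⟩
    rw [← hcard, ← Finset.card_union_of_disjoint hd]
    simpa using Finset.card_le_univ (c.vertices ∪ reach ω c true ∪ reach ω c false)
  have h1 := h.cut_union_reach_le hi
  have h2 := h.cut_union_reach_le hi'
  rcases le_total (reach ω c true).card (reach ω c false).card with hc | hc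
  · exact ⟨_, by rw [hcard]; omega, by rw [hcard]; omega, h1⟩
  · exact ⟨_, by rw [hcard]; omega, by rw [hcard]; omega, h2⟩

end Pattern

/-! ### Circuits around a corner -/

/-- The segment from the middle of the triangle `i` to one of its points. -/
def spoke (ω : Omega N) (i : Fin (2 * N)) (x : Triangle) :
    Path (vertexPoint ω i) (Surface.point ω i x) where
  toFun t := Surface.point ω i (seg barycenter x t)
  continuous_toFun := (Surface.continuous_point ω i).comp (continuous_seg _ _)
  source' := by
    simp [vertexPoint, seg]
    rfl
  target' := by
    simp [seg]
    rfl

theorem point_mate (ω : Omega N) (s : Side N) (t : unitInterval) :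
    Surface.point ω s.1 (sidePoint s.2 t) =
      Surface.point ω (ω.mate s).1 (sidePoint (ω.mate s).2 (unitInterval.symm t)) :=
  Quot.sound (Glue.side s t)

/-- The path from the middle of the triangle of `s` straight to a point of the side `s`, and from
there straight to the middle of the other triangle at this side. -/
def crossing (ω : Omega N) (s : Side N) (t : unitInterval) :
    Path (vertexPoint ω s.1) (vertexPoint ω (ω.mate s).1) :=
  (spoke ω s.1 (sidePoint s.2 t)).trans
    ((spoke ω (ω.mate s).1 (sidePoint (ω.mate s).2 (unitInterval.symm t))).symm.cast
      (point_mate ω s t) rfl)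

theorem continuous_sidePoint (r : Fin 3) : Continuous (sidePoint r) := continuous_seg _ _

theorem continuous_seg_uncurry (x : Triangle) {Y : Type*} [TopologicalSpace Y] {f : Y → Triangle}
    {g : Y → unitInterval} (hf : Continuous f) (hg : Continuous g) :
    Continuous fun y => seg x (f y) (g y) := by
  refine Continuous.subtype_mk ?_ _
  have : Continuous fun y => (f y : Fin 3 → ℝ) := continuous_subtype_val.comp hf
  fun_prop

theorem continuous_crossing (ω : Omega N) (s : Side N) :
    Continuous fun q : unitInterval × unitInterval => crossing ω s q.1 q.2 := by
  refine Path.trans_continuous_family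
    (fun t => spoke ω s.1 (sidePoint s.2 t)) ?_ (fun t => (spoke ω (ω.mate s).1
      (sidePoint (ω.mate s).2 (unitInterval.symm t))).symm.cast (point_mate ω s t) rfl) ?_
  · exact (Surface.continuous_point ω _).comp (continuous_seg_uncurry _
      ((continuous_sidePoint _).comp continuous_fst) continuous_snd)
  · exact (Surface.continuous_point ω _).comp (continuous_seg_uncurry _
      ((continuous_sidePoint _).comp (unitInterval.continuous_symm.comp continuous_fst))
      (unitInterval.continuous_symm.comp continuous_snd))

theorem edgePath_eq_crossing (ω : Omega N) (s : Side N) : edgePath ω s = crossing ω s half := by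
  have h : unitInterval.symm half = half := by
    apply Subtype.ext
    norm_num [half]
  ext t
  simp only [edgePath, crossing, Path.trans_apply]
  split_ifs
  · rfl
  · change Surface.point ω _ (seg barycenter (sidePoint _ half) _) =
      Surface.point ω _ (seg barycenter (sidePoint _ (unitInterval.symm half)) _)
    rw [h]

/-- The members of a continuous family of paths with fixed ends are homotopic. -/
theorem homotopic_of_continuous_family {X : Type*} [TopologicalSpace X] {a b : X}
    (G : unitInterval → Path a b) (hG : Continuous fun q : unitInterval × unitInterval => G q.1 q.2)
    (t t' : unitInterval) : (G t).Homotopic (G t') := by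
  have : PathConnectedSpace unitInterval := isPathConnected_iff_pathConnectedSpace.1
    ((convex_Icc (0 : ℝ) 1).isPathConnected ⟨0, by simp⟩)
  obtain ⟨γ⟩ : Joined t t' := PathConnectedSpace.joined t t'
  refine ⟨{
    toFun := fun q => G (γ q.1) q.2
    continuous_toFun := hG.comp ((γ.continuous.comp continuous_fst).prodMk continuous_snd)
    map_zero_left := fun x => ?_
    map_one_left := fun x => ?_
    prop' := ?_ }⟩
  · simp
  · simp
  · rintro u x (rfl | rfl)
    · exact (G (γ u)).source.trans (G t).source.symm
    · exact (G (γ u)).target.trans (G t).target.symm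

/-- An edge can be pushed over the side that it crosses to any other point of this side. -/
theorem edgePath_homotopic_crossing (ω : Omega N) (s : Side N) (t : unitInterval) :
    (edgePath ω s).Homotopic (crossing ω s t) := by
  rw [edgePath_eq_crossing]
  exact homotopic_of_continuous_family (crossing ω s) (continuous_crossing ω s) half t

theorem homotopic_trans_trans_symm {X : Type*} [TopologicalSpace X] {a b c d p q : X}
    (A : Path a p) (B : Path b q) (D : Path d c) (h : p = q) (h' : q = c) :
    ((A.trans (B.symm.cast h rfl)).trans (B.trans (D.symm.cast h' rfl))).Homotopic
      (A.trans (D.symm.cast (h.trans h') rfl)) := by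
  subst h h'
  simp only [Path.cast_rfl_rfl]
  rw [← Path.Homotopic.Quotient.eq]
  simp only [Path.Homotopic.Quotient.mk_trans, Path.Homotopic.Quotient.mk_symm]
  rw [Path.Homotopic.Quotient.trans_assoc, ← Path.Homotopic.Quotient.trans_assoc _ _ (.symm _),
    Path.Homotopic.Quotient.symm_trans, Path.Homotopic.Quotient.refl_trans]

theorem sidePoint_zero (r : Fin 3) : sidePoint r 0 = corner r := by
  simp [sidePoint, seg]; rfl

theorem sidePoint_one (r : Fin 3) : sidePoint r 1 = corner (r + 1) := by
  simp [sidePoint, seg]; rfl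

/-- Suppose that each edge of a walk is pushed over the side that it crosses to the point with
parameter `t` of this side, and that the points at which one pushed edge enters a triangle and the
next one leaves it always coincide. Then everything in between cancels, and there remain the segment
from the first vertex to the first of these points and the one from the last point to the last
vertex. The hypothesis compares the two lists of points, shifted against each other by one. -/
theorem Walk.toPath_homotopic {ω : Omega N} (t : unitInterval) {u v : Fin (2 * N)} (p : Walk ω u v)
    {x y : Triangle} (h : (p.darts.map fun s => sidePoint s.2 t) ++ [y] =
      x :: p.darts.map fun s => sidePoint (ω.mate s).2 (unitInterval.symm t)) :
    ∃ e : Surface.point ω u x = Surface.point ω v y,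
      p.toPath.Homotopic ((spoke ω u x).trans ((spoke ω v y).symm.cast e rfl)) := by
  induction p generalizing x with
  | nil u =>
    obtain rfl : y = x := by simpa [darts] using h
    refine ⟨rfl, ?_⟩
    simp only [Path.cast_rfl_rfl]
    exact (Path.Homotopic.trans_symm _).symm
  | cons s hs p ih =>
    subst hs
    simp only [darts, List.map_cons, List.cons_append, List.cons.injEq] at h
    obtain ⟨rfl, h⟩ := h
    obtain ⟨e, he⟩ := ih h
    refine ⟨(point_mate ω s t).trans e, ?_⟩
    simp only [toPath, Path.cast_rfl_rfl]
    exact ((edgePath_homotopic_crossing ω s t).hcomp he).trans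
      (homotopic_trans_trans_symm _ _ _ _ _)

/-! ### Walks and patterns -/

theorem ofFn_append_singleton {α : Type*} {n : ℕ} (f : Fin (n + 1) → α) :
    List.ofFn f ++ [f 0] = f 0 :: List.ofFn fun i => f (i + 1) := by
  rw [List.ofFn_succ, List.ofFn_succ' fun i => f (i + 1)]
  simp [Fin.coeSucc_eq_succ]

namespace Walk

variable {ω : Omega N}

/-- The start vertices of the darts of a walk, followed by its end, are its start followed by the
end vertices of the darts. -/
theorem map_fst_darts {u v : Fin (2 * N)} (p : Walk ω u v) :
    p.darts.map Prod.fst ++ [v] = u :: p.darts.map fun s => (ω.mate s).1 := by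
  induction p with
  | nil u => rfl
  | cons s h p ih => simp [darts, h, ih]

/-- The property of `map_fst_darts` characterizes the lists of darts of walks. -/
theorem exists_darts_eq {u v : Fin (2 * N)} (l : List (Side N))
    (h : l.map Prod.fst ++ [v] = u :: l.map fun s => (ω.mate s).1) :
    ∃ p : Walk ω u v, p.darts = l := by
  induction l generalizing u with
  | nil =>
    obtain rfl : v = u := by simpa using h
    exact ⟨.nil v, rfl⟩
  | cons s l ih =>
    simp only [List.map_cons, List.cons_append, List.cons.injEq] at h
    obtain ⟨p, rfl⟩ := ih h.2
    exact ⟨.cons s h.1 p, rfl⟩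

end Walk

namespace Pattern

variable {n : ℕ} {ω : Omega N} {c : Pattern N n}

theorem Occurs.exists_walk (h : Occurs ω c) :
    ∃ p : Walk ω (c.vertex 0) (c.vertex 0), p.darts = List.ofFn c.outSide := by
  refine Walk.exists_darts_eq _ ?_
  rw [List.map_ofFn, List.map_ofFn]
  have e : ((fun s => (ω.mate s).1) ∘ c.outSide) = fun i => c.vertex (i + 1) :=
    funext fun i => congrArg Prod.fst (h i)
  rw [e]
  exact ofFn_append_singleton c.vertex

theorem Occurs.isCircuit (h : Occurs ω c) {u : Fin (2 * N)} {p : Walk ω u u}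
    (hp : p.darts = List.ofFn c.outSide) : p.IsCircuit := by
  refine ⟨by simp [hp], ?_, ?_⟩
  · rw [hp, List.map_ofFn, List.nodup_ofFn]
    exact c.vertex_injective
  · simp only [hp, List.mem_ofFn, forall_exists_index, forall_apply_eq_imp_iff]
    rintro i ⟨j, hij⟩
    rw [h] at hij
    symm at hij
    have := c.vertex_injective (congrArg Prod.fst hij)
    subst this
    exact c.inn_ne_out _ (congrArg Prod.snd hij)

/-- A circuit that makes the same turn at each of its vertices goes around a corner of the
triangulation. -/
theorem Occurs.isContractible (h : Occurs ω c) {u : Fin (2 * N)} {p : Walk ω u u}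
    (hp : p.darts = List.ofFn c.outSide) {b : Bool} (hb : ∀ i, c.turn i = b) :
    p.IsContractible := by
  obtain ⟨t, ht⟩ : ∃ t : unitInterval, ∀ i, sidePoint (c.inn i) (unitInterval.symm t) =
      sidePoint (c.out i) t := by
    cases b
    · refine ⟨1, fun i => ?_⟩
      rw [unitInterval.symm_one, sidePoint_one, sidePoint_zero, inn, hb]
      rfl
    · refine ⟨0, fun i => ?_⟩
      rw [unitInterval.symm_zero, sidePoint_one, sidePoint_zero, inn, hb, add_assoc]
      congr 1
      exact add_zero (c.out i)
  obtain ⟨e, he⟩ := p.toPath_homotopic t (x := sidePoint (c.out 0) t) (y := sidePoint (c.out 0) t)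
    (by
      rw [hp, List.map_ofFn, List.map_ofFn]
      have e : ((fun s => sidePoint (ω.mate s).2 (unitInterval.symm t)) ∘ c.outSide) =
          fun i => sidePoint (c.out (i + 1)) t := funext fun i => by
        change sidePoint (ω.mate (c.outSide i)).2 _ = _
        rw [h, ← ht]
        rfl
      rw [e]
      exact ofFn_append_singleton fun i => sidePoint (c.out i) t)
  refine he.trans ?_
  simp only [Path.cast_rfl_rfl]
  exact Path.Homotopic.trans_symm _

theorem exists_cut_lt_card_of_isContractible (h : Occurs ω c) {u : Fin (2 * N)} {p : Walk ω u u}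
    (hp : p.darts = List.ofFn c.outSide) (hc : p.IsContractible) {i i' : Fin (n + 1)}
    (hi : c.turn i = true) (hi' : c.turn i' = false) :
    ∃ A : Finset (Fin (2 * N)), 2 * A.card ≤ 2 * N + (n + 1) ∧ cut ω A < A.card ∧ cut ω A ≤ n := by
  refine h.exists_cut_lt_card hi hi' fun a ha => ?_
  have := ha.sum_rise_eq_zero hc
  rwa [hp, List.map_ofFn, List.sum_ofFn] at this

/-- The pattern of a cyclic sequence of darts of a graph. -/
theorem exists_outSide_eq (d : Fin (n + 1) → Side N) (h : ∀ i, (ω.mate (d i)).1 = (d (i + 1)).1)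
    (hinj : Function.Injective fun i => (d i).1) (hne : ∀ i, ω.mate (d i) ≠ d (i + 1)) :
    ∃ c : Pattern N n, Occurs ω c ∧ c.outSide = d := by
  let c : Pattern N n := ⟨fun i => (d i).1, fun i => (d i).2,
    fun i => decide ((ω.mate (d (i - 1))).2 = (d i).2 + 2), hinj⟩
  refine ⟨c, fun i => ?_, rfl⟩
  change ω.mate (d i) = ((d (i + 1)).1, (d (i + 1)).2 + if decide _ then 2 else 1)
  rw [add_sub_cancel_right]
  have h1 := h i
  have h2 : (ω.mate (d i)).2 ≠ (d (i + 1)).2 := fun h2 => hne i (Prod.ext h1 h2)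
  refine Prod.ext h1 ?_
  change (ω.mate (d i)).2 = (d (i + 1)).2 + if decide _ then 2 else 1
  generalize (ω.mate (d i)).2 = r at h2
  generalize (d (i + 1)).2 = r' at h2
  revert r r'
  decide

end Pattern

/-- Every circuit has a pattern. -/
theorem Walk.IsCircuit.exists_pattern {ω : Omega N} {u : Fin (2 * N)} {p : Walk ω u u}
    (hp : p.IsCircuit) :
    ∃ (n : ℕ) (c : Pattern N n), c.Occurs ω ∧ p.darts = List.ofFn c.outSide := by
  obtain ⟨h0, h1, h2⟩ := hp
  obtain ⟨n, hn⟩ : ∃ n, p.darts.length = n + 1 :=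
    Nat.exists_eq_succ_of_ne_zero (by simpa using h0)
  obtain ⟨d, hd⟩ : ∃ d : Fin (n + 1) → Side N, p.darts = List.ofFn d :=
    ⟨fun i => p.darts.get (i.cast hn.symm), by
      rw [List.ofFn_congr hn.symm]
      simp⟩
  have h3 := p.map_fst_darts
  rw [hd, List.map_ofFn, List.map_ofFn] at h3
  rw [hd, List.map_ofFn, List.nodup_ofFn] at h1
  have hu : u = (d 0).1 := by
    rw [List.ofFn_succ] at h3
    simp only [List.cons_append, List.cons.injEq] at h3
    exact h3.1.symm
  rw [hu] at h3
  have h4 := (ofFn_append_singleton (Prod.fst ∘ d)).symm.trans h3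
  have h5 := List.ofFn_injective (List.cons.inj h4).2
  obtain ⟨c, hc, rfl⟩ := Pattern.exists_outSide_eq d (fun i => (congrFun h5 i).symm) h1 (by
    intro i hi
    refine h2 (d i) ?_ ?_
    · rw [hd]; exact List.mem_ofFn.2 ⟨i, rfl⟩
    · rw [hd, hi]; exact List.mem_ofFn.2 ⟨i + 1, rfl⟩)
  exact ⟨n, c, hc, hd⟩

/-! ### Counting partitions into pairs -/

instance : Finite (Omega N) :=
  inferInstanceAs (Finite {m : Side N → Side N // Function.Involutive m ∧ ∀ s, m s ≠ s})

instance : Fintype (Omega N) := Fintype.ofFinite _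

@[ext]
theorem Omega.ext {ω ω' : Omega N} (h : ∀ s, ω.mate s = ω'.mate s) : ω = ω' :=
  Subtype.ext (funext h)

theorem card_side : Fintype.card (Side N) = 6 * N := by
  simp
  ring

instance : Nonempty (Omega N) := by
  have e : Side N ≃ Fin (3 * N) × Bool := Fintype.equivOfCardEq (by simp; ring)
  refine ⟨⟨fun s => e.symm ((e s).1, !(e s).2), fun s => by simp, fun s h => ?_⟩⟩
  have := congrArg e h
  simp [Prod.ext_iff] at this

/-- Relabelling of the sides. -/
def Omega.conj (e : Equiv.Perm (Side N)) (ω : Omega N) : Omega N :=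
  ⟨fun s => e (ω.mate (e.symm s)), fun s => by simp [ω.mate_mate], fun s h =>
    ω.mate_ne (e.symm s) <| by
    have h' : e (ω.mate (e.symm s)) = s := h
    rw [← e.apply_eq_iff_eq, h', e.apply_symm_apply]⟩

theorem Omega.conj_mate (e : Equiv.Perm (Side N)) (ω : Omega N) (s : Side N) :
    (ω.conj e).mate s = e (ω.mate (e.symm s)) := rfl

/-- Relabelling of the sides, as a bijection of `Ω_N`. -/
def Omega.conjEquiv (e : Equiv.Perm (Side N)) : Omega N ≃ Omega N where
  toFun := Omega.conj e
  invFun := Omega.conj e.symm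
  left_inv ω := by ext1 s; simp [conj_mate]
  right_inv ω := by ext1 s; simp [conj_mate]

theorem card_filter_conj (e : Equiv.Perm (Side N)) (P : Omega N → Prop) [DecidablePred P]
    [DecidablePred fun ω : Omega N => P (ω.conj e)] :
    (Finset.univ.filter fun ω : Omega N => P (ω.conj e)).card = (Finset.univ.filter P).card :=
  Finset.card_bij (fun ω _ => ω.conj e) (by simp) (fun _ _ _ _ h => (Omega.conjEquiv e).injective h)
    (fun ω hω => ⟨(Omega.conjEquiv e).symm ω, by
      have := (Omega.conjEquiv e).apply_symm_apply ω
      change Omega.conj e ((Omega.conjEquiv e).symm ω) = ω at this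
      simpa [this] using hω, (Omega.conjEquiv e).apply_symm_apply ω⟩)

open Classical in
/-- The number of partitions into pairs that contain `|s|` given disjoint pairs `{a i, b i}`. -/
theorem card_filter_mate_eq {ι : Type*} (a b : ι → Side N)
    (hab : Function.Injective (Sum.elim a b)) (s : Finset ι) :
    (Finset.univ.filter fun ω : Omega N => ∀ i ∈ s, ω.mate (a i) = b i).card *
      ∏ j ∈ Finset.range s.card, (6 * N - 1 - 2 * j) = Fintype.card (Omega N) := by
  have ha : Function.Injective a := fun i j h => by simpa using hab (a₁ := .inl i) (a₂ := .inl j) h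
  have hb : Function.Injective b := fun i j h => by simpa using hab (a₁ := .inr i) (a₂ := .inr j) h
  have hne (i j : ι) : a i ≠ b j := fun h => by simpa using hab (a₁ := .inl i) (a₂ := .inr j) h
  induction s using Finset.induction_on with
  | empty => simp
  | insert i s hi ih =>
    rw [Finset.card_insert_of_notMem hi, Finset.prod_range_succ_comm, ← mul_assoc, ← ih]
    congr 1
    set Y : Finset (Side N) := Finset.univ \ (insert (a i) (s.image a ∪ s.image b)) with hY
    have hYcard : Y.card = 6 * N - 1 - 2 * s.card := by
      have h1 : Disjoint (s.image a) (s.image b) := by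
        simp only [Finset.disjoint_left, Finset.mem_image]
        rintro _ ⟨j, -, rfl⟩ ⟨j', -, h⟩
        exact hne j j' h.symm
      have h2 : a i ∉ s.image a ∪ s.image b := by
        simp only [Finset.mem_union, Finset.mem_image, not_or, not_exists, not_and]
        exact ⟨fun j hj h => hi (ha h ▸ hj), fun j _ h => hne i j h.symm⟩
      rw [hY, Finset.card_sdiff_of_subset (Finset.subset_univ _), Finset.card_univ, card_side,
        Finset.card_insert_of_notMem h2, Finset.card_union_of_disjoint h1,
        Finset.card_image_of_injective _ ha, Finset.card_image_of_injective _ hb]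
      omega
    -- all sides `y` not yet paired are equally likely to be the mate of `a i`
    rw [Finset.card_eq_sum_card_fiberwise (s := Finset.univ.filter fun ω : Omega N =>
      ∀ i ∈ s, ω.mate (a i) = b i) (f := fun ω : Omega N => ω.mate (a i)) (t := Y)]
    · rw [← hYcard, mul_comm, ← smul_eq_mul, ← Finset.sum_const]
      refine Finset.sum_congr rfl fun y hy => ?_
      simp only [hY, Finset.mem_sdiff, Finset.mem_univ, true_and, Finset.mem_insert,
        Finset.mem_union, Finset.mem_image, not_or, not_exists, not_and] at hy
      obtain ⟨hy1, hy2, hy3⟩ := hy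
      rw [← card_filter_conj (Equiv.swap y (b i)), Finset.filter_filter]
      congr 1
      ext ω
      simp only [Finset.mem_filter, Finset.mem_univ, true_and, Omega.conj_mate, Equiv.symm_swap,
        Finset.forall_mem_insert]
      rw [and_comm]
      refine and_congr ?_ ?_
      · refine forall₂_congr fun j hj => ?_
        have hji : j ≠ i := fun h => hi (h ▸ hj)
        rw [Equiv.swap_apply_of_ne_of_ne (hy2 j hj) (hne j i), ← Equiv.eq_symm_apply,
          Equiv.symm_swap, Equiv.swap_apply_of_ne_of_ne (hy3 j hj) (hb.ne hji)]
      · rw [Equiv.swap_apply_of_ne_of_ne (Ne.symm hy1) (hne i i), ← Equiv.eq_symm_apply,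
          Equiv.symm_swap, Equiv.swap_apply_right]
    · intro ω hω
      simp only [Finset.coe_filter, Finset.mem_univ, true_and, Set.mem_ofPred_eq] at hω
      simp only [hY, Finset.coe_sdiff, Finset.coe_univ, Set.mem_sdiff, Set.mem_univ, true_and,
        Finset.mem_coe, Finset.mem_insert, Finset.mem_union, Finset.mem_image, not_or, not_exists,
        not_and]
      refine ⟨ω.mate_ne _, fun j hj h => ?_, fun j hj h => ?_⟩
      · have := congrArg ω.mate h
        rw [hω j hj, ω.mate_mate] at this
        exact hne i j this.symm
      · rw [← hω j hj] at h
        exact hi (ha (ω.mate_injective h) ▸ hj)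

/-- A set of sides is closed if it is a union of pairs. -/
def IsClosedUnder (ω : Omega N) (H : Finset (Side N)) : Prop := ∀ s ∈ H, ω.mate s ∈ H

/-- In a union of pairs, half of the elements are the smaller ones of their pairs. -/
theorem IsClosedUnder.two_mul_card_filter {ω : Omega N} {P : Finset (Side N)}
    (hP : IsClosedUnder ω P) :
    2 * (P.filter fun s => toLex s < toLex (ω.mate s)).card = P.card := by
  rw [← Finset.card_filter_add_card_filter_not (s := P) (fun s => toLex s < toLex (ω.mate s)),
    two_mul]
  congr 1
  refine Finset.card_bij (fun s _ => ω.mate s) ?_ (fun _ _ _ _ h => ω.mate_injective h) ?_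
  · intro s hs
    rw [Finset.mem_filter] at hs ⊢
    rw [ω.mate_mate]
    exact ⟨hP s hs.1, hs.2.not_gt⟩
  · intro s hs
    rw [Finset.mem_filter] at hs
    refine ⟨ω.mate s, Finset.mem_filter.2 ⟨hP s hs.1, ?_⟩, ω.mate_mate s⟩
    rw [ω.mate_mate]
    exact lt_of_le_of_ne (not_lt.1 hs.2) fun h => ω.mate_ne s (toLex.injective h)

open Classical in
/-- The number of unions of `m` pairs. -/
theorem card_filter_isClosedUnder_le (ω : Omega N) (m : ℕ) :
    ((Finset.univ.powersetCard (2 * m)).filter fun H => IsClosedUnder ω H).card ≤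
      (3 * N).choose m := by
  set R : Finset (Side N) := Finset.univ.filter fun s => toLex s < toLex (ω.mate s) with hR
  have hRcard : R.card = 3 * N := by
    have h1 := IsClosedUnder.two_mul_card_filter (ω := ω) (P := Finset.univ)
      fun s _ => Finset.mem_univ _
    rw [Finset.card_univ, card_side] at h1
    rw [hR]
    omega
  rw [← hRcard, ← Finset.card_powersetCard]
  refine Finset.card_le_card_of_injOn (fun H => H ∩ R) ?_ ?_
  · intro H hH
    simp only [Finset.coe_filter, Finset.mem_powersetCard, Set.mem_ofPred_eq] at hH
    simp only [Finset.mem_coe, Finset.mem_powersetCard]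
    refine ⟨Finset.inter_subset_right, ?_⟩
    have h1 := hH.2.two_mul_card_filter
    rw [hH.1.2] at h1
    have h2 : H ∩ R = H.filter fun s => toLex s < toLex (ω.mate s) := by
      ext s; simp [hR]
    rw [h2]
    omega
  · have hsub (H H' : Finset (Side N)) (hH : IsClosedUnder ω H) (hH' : IsClosedUnder ω H')
        (h : H ∩ R = H' ∩ R) : H ⊆ H' := by
      intro s hs
      rcases lt_trichotomy (toLex s) (toLex (ω.mate s)) with hlt | heq | hgt
      · have : s ∈ H ∩ R := by simp [hs, hR, hlt]
        rw [h] at this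
        exact (Finset.mem_inter.1 this).1
      · exact absurd (toLex.injective heq).symm (ω.mate_ne s)
      · have : ω.mate s ∈ H ∩ R := by simp [hH s hs, hR, hgt, ω.mate_mate]
        rw [h] at this
        have := hH' _ (Finset.mem_inter.1 this).1
        rwa [ω.mate_mate] at this
    intro H hH H' hH' h
    simp only [Finset.coe_filter, Set.mem_ofPred_eq] at hH hH'
    exact (hsub H H' hH.2 hH'.2 h).antisymm (hsub H' H hH'.2 hH.2 h.symm)

theorem choose_mul_self_le (n m : ℕ) : n.choose m * n.choose m ≤ (2 * n).choose (2 * m) := by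
  rw [two_mul, two_mul, Nat.add_choose_eq]
  exact Finset.single_le_sum (f := fun ij : ℕ × ℕ => n.choose ij.1 * n.choose ij.2)
    (fun _ _ => Nat.zero_le _) (Finset.HasAntidiagonal.mem_antidiagonal.2 rfl : (m, m) ∈ _)

open Classical in
/-- A given set of `2 m` sides is a union of pairs with probability at most `1 / (3N choose m)`. By
symmetry it suffices to average over all sets of this size. -/
theorem card_isClosedUnder_mul_choose_le {m : ℕ} {H : Finset (Side N)} (hH : H.card = 2 * m) :
    (Finset.univ.filter fun ω : Omega N => IsClosedUnder ω H).card * (3 * N).choose m ≤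
      Fintype.card (Omega N) := by
  have hsym (H' : Finset (Side N)) (hH' : H'.card = 2 * m) :
      (Finset.univ.filter fun ω : Omega N => IsClosedUnder ω H').card =
        (Finset.univ.filter fun ω : Omega N => IsClosedUnder ω H).card := by
    obtain ⟨e, he⟩ : ∃ e : Equiv.Perm (Side N), H.map e.toEmbedding = H' := by
      have hc : Fintype.card H = Fintype.card H' := by simp [hH, hH']
      refine ⟨(Fintype.equivOfCardEq hc).extendSubtype, ?_⟩
      refine Finset.eq_of_subset_of_card_le (fun x hx => ?_) (by simp [hH, hH'])
      obtain ⟨y, hy, rfl⟩ := Finset.mem_map.1 hx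
      exact Equiv.extendSubtype_mem (Fintype.equivOfCardEq hc) y hy
    rw [← card_filter_conj e]
    subst he
    refine congrArg Finset.card (Finset.filter_congr fun ω _ => ?_)
    simp only [IsClosedUnder, Omega.conj_mate, Finset.mem_map_equiv, Equiv.symm_apply_apply]
    exact e.symm.forall_congr_right (q := fun s => s ∈ H → ω.mate s ∈ H)
  set p := (Finset.univ.filter fun ω : Omega N => IsClosedUnder ω H).card
  have h1 : ((6 * N).choose (2 * m)) * p ≤ Fintype.card (Omega N) * (3 * N).choose m := by
    calc ((6 * N).choose (2 * m)) * p
        = ∑ H' ∈ (Finset.univ : Finset (Side N)).powersetCard (2 * m),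
          (Finset.univ.filter fun ω : Omega N => IsClosedUnder ω H').card := by
          rw [Finset.sum_congr rfl fun H' hH' => hsym H' (Finset.mem_powersetCard.1 hH').2,
            Finset.sum_const, Finset.card_powersetCard, Finset.card_univ, card_side, smul_eq_mul]
      _ = ∑ ω : Omega N, ((Finset.univ.powersetCard (2 * m)).filter
          fun H' => IsClosedUnder ω H').card := by
          simp_rw [Finset.card_filter]
          exact Finset.sum_comm
      _ ≤ ∑ ω : Omega N, (3 * N).choose m :=
          Finset.sum_le_sum fun ω _ => card_filter_isClosedUnder_le ω m
      _ = _ := by simp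
  have h2 := choose_mul_self_le (3 * N) m
  rw [show 2 * (3 * N) = 6 * N by ring] at h2
  rcases Nat.eq_zero_or_pos ((3 * N).choose m) with h0 | hpos
  · simp [h0]
  · refine Nat.le_of_mul_le_mul_right ?_ hpos
    calc p * (3 * N).choose m * (3 * N).choose m
        = ((3 * N).choose m * (3 * N).choose m) * p := by ring
      _ ≤ (6 * N).choose (2 * m) * p := Nat.mul_le_mul_right _ h2
      _ ≤ _ := h1

/-! ### Expectation and probability -/

/-- The expectation of a random variable on `Ω_N`. -/
def expect (f : Omega N → ℝ) : ℝ := (∑ ω, f ω) / Fintype.card (Omega N)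

theorem card_Omega_pos : (0 : ℝ) < Fintype.card (Omega N) := by
  exact_mod_cast Fintype.card_pos

theorem expect_mono {f g : Omega N → ℝ} (h : ∀ ω, f ω ≤ g ω) : expect f ≤ expect g :=
  div_le_div_of_nonneg_right (Finset.sum_le_sum fun ω _ => h ω) card_Omega_pos.le

theorem expect_sum {ι : Type*} (s : Finset ι) (f : ι → Omega N → ℝ) :
    expect (fun ω => ∑ i ∈ s, f i ω) = ∑ i ∈ s, expect (f i) := by
  simp only [expect, ← Finset.sum_div]
  rw [Finset.sum_comm]

theorem expect_add (f g : Omega N → ℝ) :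
    expect (fun ω => f ω + g ω) = expect f + expect g := by
  simp only [expect, ← add_div, Finset.sum_add_distrib]

theorem expect_const_mul (c : ℝ) (f : Omega N → ℝ) :
    expect (fun ω => c * f ω) = c * expect f := by
  simp only [expect, ← Finset.mul_sum, mul_div_assoc]

open Classical in
theorem prob_eq_expect (A : Set (Omega N)) :
    prob N A = expect fun ω => if ω ∈ A then 1 else 0 := by
  unfold prob expect
  rw [Nat.card_eq_fintype_card, Nat.card_eq_fintype_card, Finset.sum_boole, Fintype.card_subtype]

theorem prob_nonneg (A : Set (Omega N)) : 0 ≤ prob N A :=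
  div_nonneg (Nat.cast_nonneg _) (Nat.cast_nonneg _)

/-- Markov's inequality. -/
theorem prob_le_expect {A : Set (Omega N)} {f : Omega N → ℝ} (h0 : ∀ ω, 0 ≤ f ω)
    (h1 : ∀ ω ∈ A, 1 ≤ f ω) : prob N A ≤ expect f := by
  classical
  rw [prob_eq_expect]
  refine expect_mono fun ω => ?_
  split_ifs with h
  · exact h1 ω h
  · exact h0 ω

theorem prob_mono {A B : Set (Omega N)} (h : A ⊆ B) : prob N A ≤ prob N B := by
  classical
  rw [prob_eq_expect B]
  refine prob_le_expect (fun ω => by split_ifs <;> simp) fun ω hω => by simp [h hω]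

theorem prob_union_le (A B : Set (Omega N)) : prob N (A ∪ B) ≤ prob N A + prob N B := by
  classical
  rw [prob_eq_expect A, prob_eq_expect B, ← expect_add]
  refine prob_le_expect (fun ω => by positivity) fun ω hω => ?_
  rcases hω with h | h
  · simp only [h, if_true]; split_ifs <;> simp
  · simp only [h, if_true]; split_ifs <;> simp

theorem prob_diff {A B : Set (Omega N)} (h : B ⊆ A) : prob N (A \ B) = prob N A - prob N B := by
  classical
  rw [eq_sub_iff_add_eq, prob_eq_expect, prob_eq_expect A, prob_eq_expect B, ← expect_add]
  congr 1
  ext ω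
  by_cases h1 : ω ∈ B
  · simp [h1, h h1]
  · simp [h1]

/-! ### Sets of vertices with few outgoing half-edges -/

/-- The half-edges at the vertices in `A`. -/
def sides (A : Finset (Fin (2 * N))) : Finset (Side N) := A ×ˢ Finset.univ

theorem mem_sides {A : Finset (Fin (2 * N))} {s : Side N} : s ∈ sides A ↔ s.1 ∈ A := by
  simp [sides]

theorem card_sides (A : Finset (Fin (2 * N))) : (sides A).card = 3 * A.card := by
  simp [sides, mul_comm]

/-- The half-edges counted by `cut ω A`. -/
def outgoing (ω : Omega N) (A : Finset (Fin (2 * N))) : Finset (Side N) :=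
  Finset.univ.filter fun s : Side N => s.1 ∈ A ∧ (ω.mate s).1 ∉ A

theorem outgoing_subset (ω : Omega N) (A : Finset (Fin (2 * N))) : outgoing ω A ⊆ sides A := by
  intro s hs
  rw [mem_sides]
  exact (Finset.mem_filter.1 hs).2.1

theorem isClosedUnder_sdiff_outgoing (ω : Omega N) (A : Finset (Fin (2 * N))) :
    IsClosedUnder ω (sides A \ outgoing ω A) := by
  intro s hs
  simp only [outgoing, Finset.mem_sdiff, mem_sides, Finset.mem_filter, Finset.mem_univ,
    true_and, not_and, not_not, ω.mate_mate] at hs ⊢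
  exact ⟨hs.2 hs.1, fun _ => hs.1⟩

theorem card_sdiff_outgoing (ω : Omega N) (A : Finset (Fin (2 * N))) :
    (sides A \ outgoing ω A).card + cut ω A = 3 * A.card := by
  rw [← card_sides]
  exact Finset.card_sdiff_add_card_eq_card (outgoing_subset ω A)

/-- The sets of `n` vertices with exactly `b` outgoing half-edges. -/
def cutSets (ω : Omega N) (n b : ℕ) : Finset (Finset (Fin (2 * N))) :=
  (Finset.univ.powersetCard n).filter fun A => cut ω A = b

theorem mem_cutSets {ω : Omega N} {n b : ℕ} {A : Finset (Fin (2 * N))} :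
    A ∈ cutSets ω n b ↔ A.card = n ∧ cut ω A = b := by
  simp [cutSets, Finset.mem_powersetCard]

/-- The parity constraint on the number of outgoing half-edges. -/
theorem exists_card_eq (ω : Omega N) {A : Finset (Fin (2 * N))} (h : cut ω A ≤ A.card) :
    ∃ q, A.card = cut ω A + 2 * q := by
  have h1 := (isClosedUnder_sdiff_outgoing ω A).two_mul_card_filter
  have h2 := card_sdiff_outgoing ω A
  exact ⟨(A.card - cut ω A) / 2, by omega⟩

open Classical in
/-- The first moment bound: choose the set and its outgoing half-edges; the remaining half-edges of
the set are paired among themselves. -/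
theorem sum_card_cutSets_mul_choose_le (b q : ℕ) :
    (∑ ω : Omega N, (cutSets ω (b + 2 * q) b).card) * N.choose q ≤
      (3 * (b + 2 * q)).choose b * Fintype.card (Omega N) := by
  set n := b + 2 * q with hn
  by_cases hnN : n ≤ 2 * N
  swap
  · have : ∀ ω : Omega N, (cutSets ω n b).card = 0 := by
      intro ω
      rw [Finset.card_eq_zero, Finset.eq_empty_iff_forall_notMem]
      intro A hA
      have h1 := Finset.card_le_univ A
      rw [(mem_cutSets.1 hA).1, Fintype.card_fin] at h1
      exact hnN h1
    simp [this]
  set I : Finset (Σ _ : Finset (Fin (2 * N)), Finset (Side N)) :=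
    ((Finset.univ : Finset (Fin (2 * N))).powersetCard n).sigma fun A => (sides A).powersetCard b
  have hI : I.card = (2 * N).choose n * (3 * n).choose b := by
    rw [Finset.card_sigma, Finset.sum_congr rfl fun A hA => ?_, Finset.sum_const,
      Finset.card_powersetCard, Finset.card_univ, Fintype.card_fin, smul_eq_mul]
    rw [Finset.card_powersetCard, card_sides, (Finset.mem_powersetCard.1 hA).2]
  have h1 (ω : Omega N) : (cutSets ω n b).card ≤
      (I.filter fun x => IsClosedUnder ω (sides x.1 \ x.2)).card := by
    refine Finset.card_le_card_of_injOn (fun A => ⟨A, outgoing ω A⟩) (fun A hA => ?_)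
      fun A _ A' _ h => congrArg Sigma.fst h
    obtain ⟨hA1, hA2⟩ := mem_cutSets.1 hA
    simp only [Finset.mem_coe, Finset.mem_filter, I, Finset.mem_sigma, Finset.mem_powersetCard]
    exact ⟨⟨⟨Finset.subset_univ _, hA1⟩, outgoing_subset ω A, hA2⟩,
      isClosedUnder_sdiff_outgoing ω A⟩
  have h2 : ∑ ω : Omega N, (cutSets ω n b).card ≤
      ∑ x ∈ I, (Finset.univ.filter fun ω : Omega N => IsClosedUnder ω (sides x.1 \ x.2)).card := by
    refine (Finset.sum_le_sum fun ω _ => h1 ω).trans (le_of_eq ?_)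
    simp_rw [Finset.card_filter]
    exact Finset.sum_comm
  have h3 : ∀ x ∈ I, (Finset.univ.filter fun ω : Omega N =>
      IsClosedUnder ω (sides x.1 \ x.2)).card * (3 * N).choose (n + q) ≤
        Fintype.card (Omega N) := by
    intro x hx
    simp only [I, Finset.mem_sigma, Finset.mem_powersetCard] at hx
    refine card_isClosedUnder_mul_choose_le ?_
    rw [Finset.card_sdiff_of_subset hx.2.1, card_sides, hx.1.2, hx.2.2]
    omega
  have h4 : (2 * N).choose n * N.choose q ≤ (3 * N).choose (n + q) := by
    rw [show 3 * N = 2 * N + N by ring, Nat.add_choose_eq]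
    exact Finset.single_le_sum (f := fun ij : ℕ × ℕ => (2 * N).choose ij.1 * N.choose ij.2)
      (fun _ _ => Nat.zero_le _) (Finset.HasAntidiagonal.mem_antidiagonal.2 rfl :
        (n, q) ∈ Finset.HasAntidiagonal.antidiagonal (n + q))
  refine Nat.le_of_mul_le_mul_left ?_ (Nat.choose_pos hnN)
  calc (2 * N).choose n * ((∑ ω : Omega N, (cutSets ω n b).card) * N.choose q)
      = (∑ ω : Omega N, (cutSets ω n b).card) * ((2 * N).choose n * N.choose q) := by ring
    _ ≤ (∑ x ∈ I, (Finset.univ.filter fun ω : Omega N =>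
          IsClosedUnder ω (sides x.1 \ x.2)).card) * (3 * N).choose (n + q) :=
        Nat.mul_le_mul h2 h4
    _ ≤ ∑ x ∈ I, Fintype.card (Omega N) := by
        rw [Finset.sum_mul]
        exact Finset.sum_le_sum h3
    _ = _ := by rw [Finset.sum_const, hI, smul_eq_mul]; ring

theorem expect_card_cutSets_le {b q : ℕ} (hq : q ≤ N) :
    expect (fun ω : Omega N => ((cutSets ω (b + 2 * q) b).card : ℝ)) ≤
      (3 * (b + 2 * q)).choose b / N.choose q := by
  have h := sum_card_cutSets_mul_choose_le (N := N) b q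
  have hpos : (0 : ℝ) < N.choose q := by exact_mod_cast Nat.choose_pos hq
  rw [expect, div_le_div_iff₀ card_Omega_pos hpos]
  exact_mod_cast h

/-- Up to `q = 2n/3` the binomial coefficient `n choose q` is at least linear in `n` and grows
exponentially in `q`. -/
theorem pow_mul_le_choose {n p : ℕ} (h : 3 * (p + 1) ≤ 2 * n) :
    (3 / 2 : ℝ) ^ p * (n - p) ≤ n.choose (p + 1) := by
  induction p generalizing n with
  | zero => simp
  | succ p ih =>
    obtain ⟨m, rfl⟩ : ∃ m, n = m + 1 := Nat.exists_eq_succ_of_ne_zero (by omega)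
    have h1 := ih (n := m) (by omega)
    have h2 : ((m + 1).choose (p + 2) : ℝ) * (p + 2) = (m + 1) * m.choose (p + 1) := by
      have := Nat.add_one_mul_choose_eq m (p + 1)
      exact_mod_cast this.symm
    have h3 : (3 * (p + 2) : ℝ) ≤ 2 * (m + 1) := by exact_mod_cast h
    have h4 : (0 : ℝ) ≤ m.choose (p + 1) := Nat.cast_nonneg _
    have h5 : (3 / 2 : ℝ) * m.choose (p + 1) ≤ (m + 1).choose (p + 2) := by
      have h6 : (0 : ℝ) < p + 2 := by positivity
      nlinarith
    push_cast
    calc (3 / 2 : ℝ) ^ (p + 1) * (m + 1 - (p + 1)) = 3 / 2 * ((3 / 2) ^ p * (m - p)) := by ring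
      _ ≤ _ := by linarith

open Classical in
/-- The sets of at most about half of the vertices that have fewer outgoing half-edges than
elements, and at most `k`. In a small set with this property the edges outnumber the vertices. -/
def tightSets (ω : Omega N) (k : ℕ) : Finset (Finset (Fin (2 * N))) :=
  Finset.univ.filter fun A => A.card ≤ N + k ∧ cut ω A < A.card ∧ cut ω A ≤ k

theorem card_tightSets_le (ω : Omega N) (k : ℕ) :
    (tightSets ω k).card ≤ ∑ b ∈ Finset.range (k + 1), ∑ p ∈ Finset.range ((N + k) / 2),
      (cutSets ω (b + 2 * (p + 1)) b).card := by
  classical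
  refine le_trans (Finset.card_le_card (t := (Finset.range (k + 1)).biUnion fun b =>
    (Finset.range ((N + k) / 2)).biUnion fun p => cutSets ω (b + 2 * (p + 1)) b) ?_) ?_
  · intro A hA
    obtain ⟨h1, h2, h3⟩ := (Finset.mem_filter.1 hA).2
    obtain ⟨q, hq⟩ := exists_card_eq ω h2.le
    simp only [Finset.mem_biUnion, Finset.mem_range, mem_cutSets]
    exact ⟨cut ω A, by omega, q - 1, by omega, by omega, rfl⟩
  · exact Finset.card_biUnion_le.trans (Finset.sum_le_sum fun b _ => Finset.card_biUnion_le)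

/-- The expected number of tight sets is `O(1 / N)`. -/
theorem exists_expect_tightSets_le (k : ℕ) : ∃ C : ℝ, ∀ N : ℕ, 3 * k + 1 ≤ N →
    expect (fun ω : Omega N => ((tightSets ω k).card : ℝ)) ≤ C / N := by
  set t : ℕ → ℝ := fun p => (3 * (k + 2 * (p + 1)) : ℝ) ^ k * (2 / 3) ^ p with ht
  have hsum : Summable t := by
    have h1 : Summable fun p : ℕ => (p : ℝ) ^ k * (2 / 3 : ℝ) ^ p :=
      summable_pow_mul_geometric_of_norm_lt_one k (by norm_num)
    refine Summable.of_nonneg_of_le (fun p => by positivity) (fun p => ?_)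
      (((summable_nat_add_iff 1).2 h1).mul_left ((3 * (k + 2) : ℝ) ^ k * (3 / 2)))
    have h2 : (3 * (k + 2 * (p + 1)) : ℝ) ≤ 3 * (k + 2) * (p + 1) := by
      have : (0 : ℝ) ≤ k * p := by positivity
      linarith
    calc t p ≤ (3 * (k + 2) * (p + 1) : ℝ) ^ k * (2 / 3) ^ p := by
          simp only [ht]
          gcongr
      _ = _ := by
          push_cast
          rw [mul_pow]
          ring
  refine ⟨(k + 1) * (3 * ∑' p, t p), fun N hN => ?_⟩
  have hN0 : (0 : ℝ) < N := by exact_mod_cast (by omega : 0 < N)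
  calc expect (fun ω : Omega N => ((tightSets ω k).card : ℝ))
      ≤ expect (fun ω : Omega N => ∑ b ∈ Finset.range (k + 1),
          ∑ p ∈ Finset.range ((N + k) / 2), ((cutSets ω (b + 2 * (p + 1)) b).card : ℝ)) :=
        expect_mono fun ω => by exact_mod_cast card_tightSets_le ω k
    _ = ∑ b ∈ Finset.range (k + 1), ∑ p ∈ Finset.range ((N + k) / 2),
          expect fun ω : Omega N => ((cutSets ω (b + 2 * (p + 1)) b).card : ℝ) := by
        rw [expect_sum]
        exact Finset.sum_congr rfl fun b _ => expect_sum _ _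
    _ ≤ ∑ b ∈ Finset.range (k + 1), ∑ p ∈ Finset.range ((N + k) / 2), 3 / N * t p := by
        refine Finset.sum_le_sum fun b hb => Finset.sum_le_sum fun p hp => ?_
        have hb' := Finset.mem_range.1 hb
        have hp' := Finset.mem_range.1 hp
        refine (expect_card_cutSets_le (by omega)).trans ?_
        have h1 := pow_mul_le_choose (n := N) (p := p) (by omega)
        have h2 : (N : ℝ) / 3 ≤ N - p := by
          have : (3 * (p + 1) : ℝ) ≤ 2 * N := by exact_mod_cast (by omega : 3 * (p + 1) ≤ 2 * N)
          linarith
        have h3 : (3 / 2 : ℝ) ^ p * (N / 3) ≤ N.choose (p + 1) :=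
          (mul_le_mul_of_nonneg_left h2 (by positivity)).trans h1
        have h4 : ((3 * (b + 2 * (p + 1))).choose b : ℝ) ≤ (3 * (k + 2 * (p + 1)) : ℝ) ^ k := by
          have : (3 * (b + 2 * (p + 1))).choose b ≤ (3 * (k + 2 * (p + 1))) ^ k :=
            (Nat.choose_le_pow _ _).trans ((Nat.pow_le_pow_left (by omega) _).trans
              (Nat.pow_le_pow_right (by omega) (by omega)))
          exact_mod_cast this
        calc ((3 * (b + 2 * (p + 1))).choose b : ℝ) / N.choose (p + 1)
            ≤ (3 * (k + 2 * (p + 1)) : ℝ) ^ k / ((3 / 2 : ℝ) ^ p * (N / 3)) := by gcongr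
          _ = 3 / N * t p := by
            simp only [ht]
            rw [show (2 / 3 : ℝ) = (3 / 2)⁻¹ by norm_num, inv_pow]
            field_simp
    _ ≤ ∑ b ∈ Finset.range (k + 1), 3 / N * ∑' p, t p := by
        refine Finset.sum_le_sum fun b _ => ?_
        rw [← Finset.mul_sum]
        refine mul_le_mul_of_nonneg_left (hsum.sum_le_tsum _ fun p _ => by positivity)
          (by positivity)
    _ = _ := by
        rw [Finset.sum_const, Finset.card_range, nsmul_eq_mul]
        push_cast
        ring

open Classical in
/-- The sets of at most `d` vertices that have at most as many outgoing half-edges as elements. -/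
def cyclicSets (ω : Omega N) (d : ℕ) : Finset (Finset (Fin (2 * N))) :=
  Finset.univ.filter fun A => A.card ≤ d ∧ cut ω A ≤ A.card

/-- The expected number of small cyclic sets is bounded. -/
theorem exists_expect_cyclicSets_le (d : ℕ) : ∃ C : ℝ, ∀ N : ℕ, d ≤ N →
    expect (fun ω : Omega N => ((cyclicSets ω d).card : ℝ)) ≤ C := by
  refine ⟨∑ b ∈ Finset.range (d + 1), ∑ q ∈ Finset.range (d + 1),
    ((3 * (b + 2 * q)).choose b : ℝ), fun N hN => ?_⟩
  have hle (ω : Omega N) : (cyclicSets ω d).card ≤ ∑ b ∈ Finset.range (d + 1),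
      ∑ q ∈ Finset.range (d + 1), (cutSets ω (b + 2 * q) b).card := by
    classical
    refine le_trans (Finset.card_le_card (t := (Finset.range (d + 1)).biUnion fun b =>
      (Finset.range (d + 1)).biUnion fun q => cutSets ω (b + 2 * q) b) ?_) ?_
    · intro A hA
      obtain ⟨h1, h2⟩ := (Finset.mem_filter.1 hA).2
      obtain ⟨q, hq⟩ := exists_card_eq ω h2
      simp only [Finset.mem_biUnion, Finset.mem_range, mem_cutSets]
      exact ⟨cut ω A, by omega, q, by omega, by omega, rfl⟩
    · exact Finset.card_biUnion_le.trans (Finset.sum_le_sum fun b _ => Finset.card_biUnion_le)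
  calc expect (fun ω : Omega N => ((cyclicSets ω d).card : ℝ))
      ≤ expect (fun ω : Omega N => ∑ b ∈ Finset.range (d + 1),
          ∑ q ∈ Finset.range (d + 1), ((cutSets ω (b + 2 * q) b).card : ℝ)) :=
        expect_mono fun ω => by exact_mod_cast hle ω
    _ = ∑ b ∈ Finset.range (d + 1), ∑ q ∈ Finset.range (d + 1),
          expect fun ω : Omega N => ((cutSets ω (b + 2 * q) b).card : ℝ) := by
        rw [expect_sum]
        exact Finset.sum_congr rfl fun b _ => expect_sum _ _
    _ ≤ _ := by
        refine Finset.sum_le_sum fun b hb => Finset.sum_le_sum fun q hq => ?_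
        have hq' := Finset.mem_range.1 hq
        refine (expect_card_cutSets_le (by omega)).trans (div_le_self (Nat.cast_nonneg _) ?_)
        exact_mod_cast Nat.choose_pos (by omega : q ≤ N)

/-! ### Canonical patterns and circuits that meet -/

namespace Pattern

variable {n n' : ℕ} {ω : Omega N}

/-- The same circuit with another root. -/
def rotate (c : Pattern N n) (k : Fin (n + 1)) : Pattern N n :=
  ⟨fun i => c.vertex (i + k), fun i => c.out (i + k), fun i => c.turn (i + k),
    fun _ _ h => add_right_cancel (c.vertex_injective h)⟩

/-- The same circuit with the same root and the other orientation. -/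
def reverse (c : Pattern N n) : Pattern N n :=
  ⟨fun i => c.vertex (-i), fun i => c.inn (-i), fun i => !c.turn (-i),
    fun _ _ h => neg_injective (c.vertex_injective h)⟩

theorem reverse_inn (c : Pattern N n) (i : Fin (n + 1)) : c.reverse.inn i = c.out (-i) := by
  have key : ∀ (r : Fin 3) (t : Bool),
      ((r + if t then 2 else 1) + if !t then 2 else 1) = r := by decide
  exact key _ _

theorem reverse_third (c : Pattern N n) (i : Fin (n + 1)) : c.reverse.third i = c.third (-i) := by
  have key : ∀ (r : Fin 3) (t : Bool),
      ((r + if t then 2 else 1) + if !t then 1 else 2) = r + if t then 1 else 2 := by decide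
  exact key _ _

theorem Occurs.rotate {c : Pattern N n} (h : Occurs ω c) (k : Fin (n + 1)) :
    Occurs ω (c.rotate k) := by
  intro i
  change ω.mate (c.outSide (i + k)) = c.innSide (i + 1 + k)
  rw [h, add_right_comm]

theorem Occurs.reverse {c : Pattern N n} (h : Occurs ω c) : Occurs ω c.reverse := by
  intro i
  change ω.mate (c.innSide (-i)) = (c.vertex (-(i + 1)), c.reverse.inn (i + 1))
  rw [h.mate_innSide, reverse_inn, neg_add, ← sub_eq_add_neg]
  rfl

/-- The circuit turns to both sides. -/
def IsMixed (c : Pattern N n) : Prop := (∃ i, c.turn i = true) ∧ ∃ i, c.turn i = false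

/-- The root is the smallest vertex of the circuit, and the orientation is such that the root is
left along the larger of the two half-edges. Each circuit has exactly one such pattern. -/
structure IsCanonical (c : Pattern N n) : Prop where
  vertex_zero_le : ∀ i, c.vertex 0 ≤ c.vertex i
  inn_lt_out : c.inn 0 < c.out 0

theorem Occurs.exists_canonical {c : Pattern N n} (h : Occurs ω c) (hm : c.IsMixed) :
    ∃ c' : Pattern N n, Occurs ω c' ∧ c'.IsCanonical ∧ c'.IsMixed := by
  obtain ⟨k, hk⟩ := Finite.exists_min c.vertex
  have h0 (i : Fin (n + 1)) : (c.rotate k).vertex 0 ≤ (c.rotate k).vertex i := by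
    change c.vertex (0 + k) ≤ _
    rw [zero_add]
    exact hk _
  obtain ⟨⟨i, hi⟩, ⟨i', hi'⟩⟩ := hm
  have e (j : Fin (n + 1)) : (c.rotate k).turn (j - k) = c.turn j := by
    change c.turn (j - k + k) = _
    rw [sub_add_cancel]
  rcases lt_or_gt_of_ne ((c.rotate k).inn_ne_out 0) with hlt | hgt
  · exact ⟨c.rotate k, h.rotate k, ⟨h0, hlt⟩, ⟨i - k, by rw [e, hi]⟩, ⟨i' - k, by rw [e, hi']⟩⟩
  · refine ⟨(c.rotate k).reverse, (h.rotate k).reverse, ⟨fun j => ?_, ?_⟩, ⟨-(i' - k), ?_⟩,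
      ⟨-(i - k), ?_⟩⟩
    · change (c.rotate k).vertex (-0) ≤ (c.rotate k).vertex (-j)
      rw [neg_zero]
      exact h0 _
    · rw [reverse_inn]
      change _ < (c.rotate k).inn (-0)
      rw [neg_zero]
      exact hgt
    · change (!(c.rotate k).turn (- -(i' - k))) = true
      rw [neg_neg, e, hi']
      rfl
    · change (!(c.rotate k).turn (- -(i - k))) = false
      rw [neg_neg, e, hi]
      rfl

theorem ofNat_succ (n m : ℕ) : Fin.ofNat (n + 1) (m + 1) = Fin.ofNat (n + 1) m + 1 :=
  Fin.ext (by simp [Fin.val_add])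

theorem ofNat_eq_zero_iff (n m : ℕ) : Fin.ofNat (n + 1) m = 0 ↔ n + 1 ∣ m := by
  rw [Fin.ext_iff, Nat.dvd_iff_mod_eq_zero]
  rfl

theorem third_eq_of {c : Pattern N n} {c' : Pattern N n'} {i : Fin (n + 1)} {i' : Fin (n' + 1)}
    (ho : c.out i = c'.out i') (ht : c.third i = c'.third i') : c.turn i = c'.turn i' := by
  have key : ∀ (r : Fin 3) (t t' : Bool),
      ((r + if t then 1 else 2) = r + if t' then 1 else 2) → t = t' := by decide
  unfold third at ht
  rw [ho] at ht
  exact key _ _ _ ht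

theorem out_eq_of {c : Pattern N n} {c' : Pattern N n'} {i : Fin (n + 1)} {i' : Fin (n' + 1)}
    (hi : c.inn i = c'.inn i') (ht : c.third i = c'.third i') : c.out i = c'.out i' := by
  have key : ∀ (r r' : Fin 3) (t t' : Bool),
      ((r + if t then 2 else 1) = r' + if t' then 2 else 1) →
      ((r + if t then 1 else 2) = r' + if t' then 1 else 2) → r = r' := by decide
  exact key _ _ _ _ hi ht

theorem out_eq_or {c : Pattern N n} {c' : Pattern N n'} {i : Fin (n + 1)} {i' : Fin (n' + 1)}
    (ht : c.third i = c'.third i') : c.out i = c'.out i' ∨ c.out i = c'.inn i' := by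
  have key : ∀ (r r' : Fin 3) (t t' : Bool),
      ((r + if t then 1 else 2) = r' + if t' then 1 else 2) →
      r = r' ∨ r = r' + if t' then 2 else 1 := by decide
  exact key _ _ _ _ ht

/-- Two circuits that share a vertex, with the same orientation there, and that use the same
half-edges at all their common vertices run through the same darts forever. -/
theorem Occurs.aligned {c : Pattern N n} {c' : Pattern N n'} (h : Occurs ω c) (h' : Occurs ω c')
    (ht : ∀ i i', c.vertex i = c'.vertex i' → c.third i = c'.third i') {a : Fin (n + 1)}
    {b : Fin (n' + 1)} (hv : c.vertex a = c'.vertex b) (ho : c.out a = c'.out b) (m : ℕ) :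
    c.vertex (a + Fin.ofNat (n + 1) m) = c'.vertex (b + Fin.ofNat (n' + 1) m) ∧
      c.out (a + Fin.ofNat (n + 1) m) = c'.out (b + Fin.ofNat (n' + 1) m) := by
  induction m with
  | zero => simpa using ⟨hv, ho⟩
  | succ m ih =>
    rw [ofNat_succ, ofNat_succ, ← add_assoc, ← add_assoc]
    have h1 : c.outSide (a + Fin.ofNat (n + 1) m) = c'.outSide (b + Fin.ofNat (n' + 1) m) :=
      Prod.ext ih.1 ih.2
    have h2 := h (a + Fin.ofNat (n + 1) m)
    rw [h1, h'] at h2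
    have h3 := (congrArg Prod.fst h2).symm
    exact ⟨h3, out_eq_of (congrArg Prod.snd h2).symm (ht _ _ h3)⟩

theorem Occurs.dvd_of_aligned {c : Pattern N n} {c' : Pattern N n'} (h : Occurs ω c)
    (h' : Occurs ω c') (ht : ∀ i i', c.vertex i = c'.vertex i' → c.third i = c'.third i')
    {a : Fin (n + 1)} {b : Fin (n' + 1)} (hv : c.vertex a = c'.vertex b)
    (ho : c.out a = c'.out b) : n' + 1 ∣ n + 1 := by
  have h1 := (h.aligned h' ht hv ho (n + 1)).1
  rw [(ofNat_eq_zero_iff n (n + 1)).2 dvd_rfl, add_zero, hv] at h1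
  have h2 := c'.vertex_injective h1
  rw [left_eq_add, ofNat_eq_zero_iff] at h2
  exact h2

theorem Occurs.eq_of_aligned {c c' : Pattern N n} (h : Occurs ω c) (h' : Occurs ω c')
    (hc : ∀ i, c.vertex 0 ≤ c.vertex i) (hc' : ∀ i, c'.vertex 0 ≤ c'.vertex i)
    (ht : ∀ i i', c.vertex i = c'.vertex i' → c.third i = c'.third i') {a b : Fin (n + 1)}
    (hv : c.vertex a = c'.vertex b) (ho : c.out a = c'.out b) : c = c' := by
  have key (i : Fin (n + 1)) : c.vertex (a + i) = c'.vertex (b + i) ∧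
      c.out (a + i) = c'.out (b + i) := by
    have := h.aligned h' ht hv ho i.val
    rwa [show Fin.ofNat (n + 1) i.val = i from Fin.ext (Nat.mod_eq_of_lt i.isLt)] at this
  have h1 := (key (-a)).1
  have h2 := (key (-b)).1
  rw [add_neg_cancel] at h1 h2
  have h3 : c'.vertex (b + -a) = c'.vertex 0 :=
    le_antisymm (h1 ▸ (hc _).trans_eq h2) (hc' _)
  have hab : b = a := by
    have := c'.vertex_injective h3
    rwa [← sub_eq_add_neg, sub_eq_zero] at this
  subst hab
  have key' (i : Fin (n + 1)) : c.vertex i = c'.vertex i ∧ c.out i = c'.out i := by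
    have := key (i - b)
    rwa [add_sub_cancel] at this
  ext1
  · exact funext fun i => (key' i).1
  · exact funext fun i => (key' i).2
  · exact funext fun i => third_eq_of (key' i).2 (ht _ _ (key' i).1)

/-- Two circuits that meet and that use the same half-edges at all their common vertices are the
same, and so are their canonical patterns. -/
theorem Occurs.sigma_eq {c : Pattern N n} {c' : Pattern N n'} (h : Occurs ω c) (h' : Occurs ω c')
    (hc : c.IsCanonical) (hc' : c'.IsCanonical)
    (ht : ∀ i i', c.vertex i = c'.vertex i' → c.third i = c'.third i')
    (hm : ¬Disjoint c.vertices c'.vertices) : (⟨n, c⟩ : Σ n, Pattern N n) = ⟨n', c'⟩ := by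
  obtain ⟨x, hx, hx'⟩ := Finset.not_disjoint_iff.1 hm
  obtain ⟨a, rfl⟩ := mem_vertices.1 hx
  obtain ⟨b, hb⟩ := mem_vertices.1 hx'
  have ht' (i i') (hv : c'.vertex i = c.vertex i') : c'.third i = c.third i' :=
    (ht _ _ hv.symm).symm
  rcases out_eq_or (ht _ _ hb.symm) with ho | ho
  · have hn : n = n' := by
      have := Nat.dvd_antisymm (h'.dvd_of_aligned h ht' hb ho.symm)
        (h.dvd_of_aligned h' ht hb.symm ho)
      omega
    subst hn
    rw [h.eq_of_aligned h' hc.1 hc'.1 ht hb.symm ho]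
  · exfalso
    have hr (i i') (hv : c.vertex i = c'.reverse.vertex i') : c.third i = c'.reverse.third i' := by
      rw [reverse_third]
      exact ht _ _ hv
    have hr' (i i') (hv : c'.reverse.vertex i = c.vertex i') : c'.reverse.third i = c.third i' :=
      (hr _ _ hv.symm).symm
    have hb' : c.vertex a = c'.reverse.vertex (-b) := by
      change _ = c'.vertex (- -b)
      rw [neg_neg, hb]
    have ho' : c.out a = c'.reverse.out (-b) := by
      change _ = c'.inn (- -b)
      rw [neg_neg, ho]
    have hn : n = n' := by
      have := Nat.dvd_antisymm (h'.reverse.dvd_of_aligned h hr' hb'.symm ho'.symm)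
        (h.dvd_of_aligned h'.reverse hr hb' ho')
      omega
    subst hn
    have hmin (i : Fin (n + 1)) : c'.reverse.vertex 0 ≤ c'.reverse.vertex i := by
      change c'.vertex (-0) ≤ c'.vertex (-i)
      rw [neg_zero]
      exact hc'.1 _
    have he := h.eq_of_aligned h'.reverse hc.1 hmin hr hb' ho'
    have h1 := hc.2
    rw [he, reverse_inn] at h1
    change c'.out (-0) < c'.inn (-0) at h1
    rw [neg_zero] at h1
    exact absurd h1 hc'.2.not_gt

/-- At a vertex of a circuit inside `U`, only the third half-edge can lead out of `U`. -/
theorem Occurs.eq_third_of_mem_outgoing {c : Pattern N n} (h : Occurs ω c)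
    {U : Finset (Fin (2 * N))} (hU : c.vertices ⊆ U) {i : Fin (n + 1)} {r : Fin 3}
    (hr : (c.vertex i, r) ∈ outgoing ω U) : r = c.third i := by
  have h2 := (Finset.mem_filter.1 hr).2.2
  rcases c.eq_out_or_inn_or_third i r with rfl | rfl | h3
  · change (ω.mate (c.outSide i)).1 ∉ U at h2
    rw [h] at h2
    exact absurd (hU (vertex_mem _ _)) h2
  · change (ω.mate (c.innSide i)).1 ∉ U at h2
    rw [h.mate_innSide] at h2
    exact absurd (hU (vertex_mem _ _)) h2
  · exact h3

end Pattern

/-- If every vertex of `U` has at most one outgoing half-edge, there are at most `|U|` of them. -/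
theorem cut_le_card {ω : Omega N} {U : Finset (Fin (2 * N))}
    (h : ∀ x r r', (x, r) ∈ outgoing ω U → (x, r') ∈ outgoing ω U → r = r') :
    cut ω U ≤ U.card :=
  Finset.card_le_card_of_injOn Prod.fst (fun _ hs => (Finset.mem_filter.1 hs).2.1)
    fun s hs s' hs' he => Prod.ext he (h s.1 s.2 s'.2 hs (by rw [he]; exact hs'))

/-- If moreover some vertex of `U` has none, there are fewer than `|U|`. -/
theorem cut_lt_card {ω : Omega N} {U : Finset (Fin (2 * N))}
    (h : ∀ x r r', (x, r) ∈ outgoing ω U → (x, r') ∈ outgoing ω U → r = r') {x₀ : Fin (2 * N)}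
    (hx₀ : x₀ ∈ U) (h₀ : ∀ r, (x₀, r) ∉ outgoing ω U) : cut ω U < U.card := by
  rw [← Finset.card_erase_add_one hx₀, Nat.lt_add_one_iff]
  refine Finset.card_le_card_of_injOn Prod.fst (fun s hs => ?_)
    fun s hs s' hs' he => Prod.ext he (h s.1 s.2 s'.2 hs (by rw [he]; exact hs'))
  refine Finset.mem_erase.2 ⟨fun he => h₀ s.2 ?_, (Finset.mem_filter.1 hs).2.1⟩
  rw [← he]
  exact hs

/-! ### The number of canonical patterns -/

/-- Each of the `n + 1` entries of an injective sequence is equally often the smallest one. -/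
theorem succ_mul_card_embedding_min {α : Type*} [Fintype α] [LinearOrder α] (n : ℕ) :
    (n + 1) * Nat.card {e : Fin (n + 1) ↪ α // ∀ i, e 0 ≤ e i} =
      (Fintype.card α).descFactorial (n + 1) := by
  have h1 : (Fintype.card α).descFactorial (n + 1) = Nat.card (Fin (n + 1) ↪ α) := by
    rw [Nat.card_eq_fintype_card, Fintype.card_embedding_eq, Fintype.card_fin]
  have h2 : n + 1 = Nat.card (Fin (n + 1)) := by simp
  rw [h1]
  nth_rw 1 [h2]
  rw [← Nat.card_prod]
  refine Nat.card_congr (Equiv.ofBijective (fun p : Fin (n + 1) × {e : Fin (n + 1) ↪ α //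
    ∀ i, e 0 ≤ e i} => (Equiv.swap 0 p.1).toEmbedding.trans p.2.1) ⟨?_, ?_⟩)
  · rintro ⟨k, e, he⟩ ⟨k', e', he'⟩ h
    have h3 (i : Fin (n + 1)) : e (Equiv.swap 0 k i) = e' (Equiv.swap 0 k' i) :=
      DFunLike.congr_fun h i
    have hk := h3 k
    have hk' := h3 k'
    rw [Equiv.swap_apply_right] at hk hk'
    have h4 : e 0 = e' 0 := le_antisymm ((he _).trans_eq hk') ((he' _).trans_eq hk.symm)
    have h5 : k = k' := by
      have := e'.injective (hk.symm.trans h4)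
      have h6 : Equiv.swap 0 k' k = Equiv.swap 0 k' k' := by rw [this, Equiv.swap_apply_right]
      exact (Equiv.swap 0 k').injective h6
    subst h5
    refine Prod.ext rfl (Subtype.ext (DFunLike.ext _ _ fun i => ?_))
    have := h3 (Equiv.swap 0 k i)
    rwa [Equiv.swap_apply_self] at this
  · intro g
    obtain ⟨k, hk⟩ := Finite.exists_min g
    refine ⟨⟨k, ⟨(Equiv.swap 0 k).toEmbedding.trans g, fun i => ?_⟩⟩, ?_⟩
    · change g (Equiv.swap 0 k 0) ≤ _
      rw [Equiv.swap_apply_left]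
      exact hk _
    · ext i
      change g (Equiv.swap 0 k (Equiv.swap 0 k i)) = g i
      rw [Equiv.swap_apply_self]

/-- The words of turns that can be read along a canonical pattern of a circuit that turns to both
sides. -/
def MixedWord (n : ℕ) : Type :=
  {w : (Fin (n + 1) → Fin 3) × (Fin (n + 1) → Bool) //
    (w.1 0 + if w.2 0 then 2 else 1) < w.1 0 ∧ (∃ i, w.2 i = true) ∧ ∃ i, w.2 i = false}

theorem card_mixed_bool (n : ℕ) :
    Nat.card {t : Fin (n + 1) → Bool // (∃ i, t i = true) ∧ ∃ i, t i = false} =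
      2 ^ (n + 1) - 2 := by
  classical
  rw [Nat.card_eq_fintype_card, Fintype.card_subtype]
  have h : (Finset.univ.filter fun t : Fin (n + 1) → Bool =>
      (∃ i, t i = true) ∧ ∃ i, t i = false) =
      Finset.univ \ {fun _ => true, fun _ => false} := by
    ext t
    simp only [Finset.mem_filter, Finset.mem_univ, true_and, Finset.mem_sdiff, Finset.mem_insert,
      Finset.mem_singleton, not_or, funext_iff, not_forall, Bool.not_eq_true, Bool.not_eq_false]
    exact and_comm
  rw [h, Finset.card_sdiff_of_subset (Finset.subset_univ _), Finset.card_pair, Finset.card_univ]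
  · simp
  · intro h
    simpa using congrFun h 0

/-- Changing the orientation exchanges the two half-edges at the root, so that half of the words
are canonical. -/
theorem two_mul_card_mixedWord (n : ℕ) :
    2 * Nat.card (MixedWord n) = 3 ^ (n + 1) * (2 ^ (n + 1) - 2) := by
  classical
  have h1 : 3 ^ (n + 1) * (2 ^ (n + 1) - 2) = Nat.card ((Fin (n + 1) → Fin 3) ×
      {t : Fin (n + 1) → Bool // (∃ i, t i = true) ∧ ∃ i, t i = false}) := by
    rw [Nat.card_prod, card_mixed_bool]
    simp
  have h2 : 2 = Nat.card Bool := by simp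
  have key : ∀ (r : Fin 3) (t : Bool), ((r + if t then 2 else 1) + if !t then 2 else 1) = r := by
    decide
  have key' : ∀ (r : Fin 3) (t : Bool), (r + if t then 2 else 1) ≠ r := by decide
  let flip (w : (Fin (n + 1) → Fin 3) × (Fin (n + 1) → Bool)) :
      (Fin (n + 1) → Fin 3) × (Fin (n + 1) → Bool) :=
    (fun i => w.1 i + if w.2 i then 2 else 1, fun i => !w.2 i)
  have hflip (w) : flip (flip w) = w := by
    refine Prod.ext (funext fun i => ?_) (funext fun i => ?_)
    · exact key _ _
    · exact Bool.not_not _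
  have hmix (w) : ((∃ i, w.2 i = true) ∧ ∃ i, w.2 i = false) →
      ((∃ i, (flip w).2 i = true) ∧ ∃ i, (flip w).2 i = false) := by
    rintro ⟨⟨i, hi⟩, ⟨i', hi'⟩⟩
    exact ⟨⟨i', by simp [flip, hi']⟩, ⟨i, by simp [flip, hi]⟩⟩
  rw [h1]
  nth_rw 1 [h2]
  rw [← Nat.card_prod]
  let F : Bool × MixedWord n → (Fin (n + 1) → Fin 3) ×
      {t : Fin (n + 1) → Bool // (∃ i, t i = true) ∧ ∃ i, t i = false} := fun p =>
    if p.1 then (p.2.1.1, ⟨p.2.1.2, p.2.2.2⟩)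
      else ((flip p.2.1).1, ⟨(flip p.2.1).2, hmix _ p.2.2.2⟩)
  have hF (p) : ((F p).1, (F p).2.1) = if p.1 then p.2.1 else flip p.2.1 := by
    simp only [F]
    split_ifs <;> rfl
  have hdesc (w : MixedWord n) : ¬ ((flip w.1).1 0 + if (flip w.1).2 0 then 2 else 1) <
      (flip w.1).1 0 := by
    have h3 := congrFun (congrArg Prod.fst (hflip w.1)) 0
    change ((flip w.1).1 0 + if (flip w.1).2 0 then 2 else 1) = w.1.1 0 at h3
    rw [h3]
    exact w.2.1.not_gt
  refine Nat.card_congr (Equiv.ofBijective F ⟨?_, ?_⟩)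
  · intro p p' h
    have h3 : (if p.1 then p.2.1 else flip p.2.1) = if p'.1 then p'.2.1 else flip p'.2.1 := by
      rw [← hF, ← hF, h]
    obtain ⟨b, w⟩ := p
    obtain ⟨b', w'⟩ := p'
    cases b <;> cases b' <;> simp only [if_true, Bool.false_eq_true, if_false] at h3
    · have := congrArg flip h3
      rw [hflip, hflip] at this
      exact Prod.ext rfl (Subtype.ext this)
    · have h4 := w'.2.1
      rw [← h3] at h4
      exact absurd h4 (hdesc w)
    · have h4 := w.2.1
      rw [h3] at h4
      exact absurd h4 (hdesc w')
    · exact Prod.ext rfl (Subtype.ext h3)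
  · rintro ⟨o, t, ht⟩
    rcases lt_or_gt_of_ne (key' (o 0) (t 0)) with hlt | hgt
    · refine ⟨(true, ⟨(o, t), hlt, ht⟩), ?_⟩
      simp [F]
    · have h3 := congrFun (congrArg Prod.fst (hflip (o, t))) 0
      change ((flip (o, t)).1 0 + if (flip (o, t)).2 0 then 2 else 1) = o 0 at h3
      have h4 := hF (false, ⟨flip (o, t), by rw [h3]; exact hgt, hmix _ ht⟩)
      simp only [Bool.false_eq_true, if_false, hflip] at h4
      exact ⟨_, Prod.ext (Prod.mk.inj h4).1 (Subtype.ext (Prod.mk.inj h4).2)⟩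

/-- The canonical patterns of circuits with `n + 1` edges that turn to both sides. -/
abbrev CPattern (N n : ℕ) : Type := {c : Pattern N n // c.IsCanonical ∧ c.IsMixed}

instance (N n : ℕ) : Finite (Pattern N n) :=
  Finite.of_injective (fun c : Pattern N n => (c.vertex, c.out, c.turn)) fun c c' h => by
    simp only [Prod.mk.injEq] at h
    exact Pattern.ext h.1 h.2.1 h.2.2

/-- A canonical pattern off `W` consists of an injective sequence of vertices off `W` that starts
with the smallest one, and a word. -/
def cpatternEquiv (n : ℕ) (W : Finset (Fin (2 * N))) :
    {c : CPattern N n // Disjoint c.1.vertices W} ≃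
      {e : Fin (n + 1) ↪ {x : Fin (2 * N) // x ∉ W} // ∀ i, e 0 ≤ e i} × MixedWord n where
  toFun c := (⟨⟨fun i => ⟨c.1.1.vertex i, Finset.disjoint_left.1 c.2 (c.1.1.vertex_mem i)⟩,
    fun _ _ h => c.1.1.vertex_injective (congrArg Subtype.val h)⟩, c.1.2.1.vertex_zero_le⟩,
    ⟨(c.1.1.out, c.1.1.turn), c.1.2.1.inn_lt_out, c.1.2.2⟩)
  invFun p := ⟨⟨⟨fun i => (p.1.1 i).1, p.2.1.1, p.2.1.2,
    fun _ _ h => p.1.1.injective (Subtype.ext h)⟩, ⟨p.1.2, p.2.2.1⟩, p.2.2.2⟩, by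
      rw [Finset.disjoint_left]
      intro x hx
      obtain ⟨i, rfl⟩ := Pattern.mem_vertices.1 hx
      exact (p.1.1 i).2⟩
  left_inv _ := rfl
  right_inv _ := rfl

theorem card_cpattern (n : ℕ) (W : Finset (Fin (2 * N))) :
    2 * (n + 1) * Nat.card {c : CPattern N n // Disjoint c.1.vertices W} =
      (2 * N - W.card).descFactorial (n + 1) * (3 ^ (n + 1) * (2 ^ (n + 1) - 2)) := by
  rw [Nat.card_congr (cpatternEquiv n W), Nat.card_prod, ← two_mul_card_mixedWord,
    show 2 * N - W.card = Fintype.card {x : Fin (2 * N) // x ∉ W} by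
      rw [Fintype.card_subtype_compl]; simp, ← succ_mul_card_embedding_min]
  ring

/-- The asymptotic mean number of circuits with `n + 1` edges that turn to both sides. -/
def intensity (n : ℕ) : ℝ := (2 ^ n - 1) / (n + 1)

theorem intensity_nonneg (n : ℕ) : 0 ≤ intensity n :=
  div_nonneg (sub_nonneg.2 (one_le_pow₀ (by norm_num))) (by positivity)

theorem card_cpattern_eq (n : ℕ) (W : Finset (Fin (2 * N))) :
    (Nat.card {c : CPattern N n // Disjoint c.1.vertices W} : ℝ) =
      (2 * N - W.card).descFactorial (n + 1) * 3 ^ (n + 1) * intensity n := by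
  have h := card_cpattern n W
  have h2 : ((2 ^ (n + 1) - 2 : ℕ) : ℝ) = 2 * (2 ^ n - 1) := by
    rw [Nat.cast_sub (by rw [pow_succ]; have := Nat.one_le_two_pow (n := n); omega)]
    push_cast
    ring
  have h3 : (2 * (n + 1) * Nat.card {c : CPattern N n // Disjoint c.1.vertices W} : ℝ) =
      (2 * N - W.card).descFactorial (n + 1) * (3 ^ (n + 1) * (2 * (2 ^ n - 1))) := by
    rw [← h2]
    exact_mod_cast h
  rw [intensity]
  have h4 : (n + 1 : ℝ) ≠ 0 := by positivity
  field_simp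
  linarith

/-! ### Disjoint families of circuits -/

/-- The canonical patterns of circuits with at most `k` edges that turn to both sides. -/
abbrev Circ (N k : ℕ) : Type := Σ n : Fin k, CPattern N n

namespace Circ

variable {k : ℕ}

instance instFintype : Fintype (Circ N k) := Fintype.ofFinite _

/-- The number of edges. -/
def len (t : Circ N k) : ℕ := t.1 + 1

/-- The set of vertices. -/
def verts (t : Circ N k) : Finset (Fin (2 * N)) := t.2.1.vertices

/-- The circuit is present in the graph of `ω`. -/
def Occ (ω : Omega N) (t : Circ N k) : Prop := t.2.1.Occurs ω

theorem len_le (t : Circ N k) : t.len ≤ k := t.1.isLt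

theorem card_verts (t : Circ N k) : t.verts.card = t.len := t.2.1.card_vertices

theorem verts_nonempty (t : Circ N k) : t.verts.Nonempty := ⟨_, t.2.1.vertex_mem 0⟩

theorem eq_of_third_eq {ω : Omega N} {t t' : Circ N k} (h : t.Occ ω) (h' : t'.Occ ω)
    (ht : ∀ i i', t.2.1.vertex i = t'.2.1.vertex i' → t.2.1.third i = t'.2.1.third i')
    (hm : ¬Disjoint t.verts t'.verts) : t = t' := by
  have key := Pattern.Occurs.sigma_eq h h' t.2.2.1 t'.2.2.1 ht hm
  obtain ⟨⟨n, hn⟩, c, hc⟩ := t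
  obtain ⟨⟨n', hn'⟩, c', hc'⟩ := t'
  simp only [Sigma.mk.injEq] at key
  obtain ⟨rfl, he⟩ := key
  cases eq_of_heq he
  rfl

/-- The generating function, by the number of edges, of the patterns that avoid a given set of `m`
vertices (see `sum_pow_len`). -/
def weight (N k m : ℕ) (x : ℝ) : ℝ :=
  ∑ n ∈ Finset.range k, ((2 * N - m).descFactorial (n + 1) : ℝ) * (3 * x) ^ (n + 1) * intensity n

open Classical in
theorem sum_pow_len (W : Finset (Fin (2 * N))) (x : ℝ) :
    (∑ t : Circ N k, if Disjoint t.verts W then x ^ t.len else 0) = weight N k W.card x := by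
  rw [weight, ← Fin.sum_univ_eq_sum_range (fun n => ((2 * N - W.card).descFactorial (n + 1) : ℝ) *
    (3 * x) ^ (n + 1) * intensity n) k]
  have : ∀ n : Fin k, Fintype (CPattern N n) := fun n => Fintype.ofFinite _
  have e : (Circ.instFintype : Fintype (Circ N k)) = Sigma.instFintype :=
    Subsingleton.elim _ _
  rw [e, Fintype.sum_sigma]
  refine Finset.sum_congr rfl fun n _ => ?_
  rw [mul_pow, ← mul_assoc, mul_right_comm, ← card_cpattern_eq n W, Nat.card_eq_fintype_card,
    Fintype.card_subtype, ← nsmul_eq_mul, ← Finset.sum_const, ← Finset.sum_filter]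
  rfl

theorem weight_le_weight {m m' : ℕ} (h : m ≤ m') {x : ℝ} (hx : 0 ≤ x) :
    weight N k m' x ≤ weight N k m x := by
  refine Finset.sum_le_sum fun n _ => ?_
  have h1 : ((2 * N - m').descFactorial (n + 1) : ℝ) ≤ (2 * N - m).descFactorial (n + 1) := by
    exact_mod_cast Nat.descFactorial_le (n + 1) (by omega : 2 * N - m' ≤ 2 * N - m)
  have := intensity_nonneg n
  gcongr

theorem weight_nonneg (m : ℕ) {x : ℝ} (hx : 0 ≤ x) : 0 ≤ weight N k m x :=
  Finset.sum_nonneg fun n _ => mul_nonneg (by positivity) (intensity_nonneg n)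

/-- The patterns of the family are pairwise vertex-disjoint. -/
def PairDisj {r : ℕ} (f : Fin r → Circ N k) : Prop :=
  Pairwise fun a b => Disjoint (f a).verts (f b).verts

theorem pairDisj_cons {r : ℕ} (t : Circ N k) (f : Fin r → Circ N k) :
    PairDisj (Fin.cons t f : Fin (r + 1) → Circ N k) ↔
      (∀ a, Disjoint t.verts (f a).verts) ∧ PairDisj f := by
  constructor
  · intro h
    refine ⟨fun a => ?_, fun a b hab => ?_⟩
    · simpa using h (Fin.succ_ne_zero a).symm
    · simpa using h ((Fin.succ_injective r).ne hab)
  · rintro ⟨h1, h2⟩ a b hab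
    induction a using Fin.cases with
    | zero =>
      induction b using Fin.cases with
      | zero => exact absurd rfl hab
      | succ b => simpa using h1 b
    | succ a =>
      induction b using Fin.cases with
      | zero => simpa using (h1 a).symm
      | succ b => simpa using h2 fun h => hab (by rw [h])

open Classical in
/-- A lower bound for the generating function of the disjoint families off `W`: when the members are
chosen one after another, at most `m` vertices are excluded each time. -/
theorem pow_weight_le_sum {r m : ℕ} {x : ℝ} (hx : 0 ≤ x) (W : Finset (Fin (2 * N)))
    (hW : W.card + k * r ≤ m) :
    weight N k m x ^ r ≤ ∑ f : Fin r → Circ N k,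
      if PairDisj f ∧ ∀ a, Disjoint (f a).verts W then ∏ a, x ^ (f a).len else 0 := by
  induction r generalizing W with
  | zero =>
    have h : PairDisj (default : Fin 0 → Circ N k) := fun a => a.elim0
    simpa [Finset.filter_nonempty_iff] using h
  | succ r ih =>
    rw [← (Fin.consEquiv fun _ : Fin (r + 1) => Circ N k).sum_comp, Fintype.sum_prod_type]
    have hterm (t : Circ N k) : (if Disjoint t.verts W then x ^ t.len else 0) * weight N k m x ^ r ≤
        ∑ f : Fin r → Circ N k,
          if PairDisj (Fin.cons t f : Fin (r + 1) → Circ N k) ∧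
            ∀ a, Disjoint ((Fin.cons t f : Fin (r + 1) → Circ N k) a).verts W then
              ∏ a, x ^ ((Fin.cons t f : Fin (r + 1) → Circ N k) a).len else 0 := by
      by_cases ht : Disjoint t.verts W
      · have h1 := ih (W ∪ t.verts) (by
          have h2 := Finset.card_union_le W t.verts
          have h3 := t.card_verts
          have h4 := t.len_le
          rw [Nat.mul_succ] at hW
          omega)
        rw [if_pos ht]
        refine (mul_le_mul_of_nonneg_left h1 (pow_nonneg hx _)).trans ?_
        rw [Finset.mul_sum]
        refine Finset.sum_le_sum fun f _ => le_of_eq ?_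
        have hiff : (PairDisj (Fin.cons t f : Fin (r + 1) → Circ N k) ∧
            ∀ a, Disjoint ((Fin.cons t f : Fin (r + 1) → Circ N k) a).verts W) ↔
            (PairDisj f ∧ ∀ a, Disjoint (f a).verts (W ∪ t.verts)) := by
          rw [pairDisj_cons, Fin.forall_fin_succ]
          simp only [Fin.cons_zero, Fin.cons_succ, Finset.disjoint_union_right, forall_and,
            disjoint_comm (a := t.verts) (b := (f _).verts)]
          tauto
        simp only [hiff, Fin.prod_univ_succ, Fin.cons_zero, Fin.cons_succ]
        split_ifs <;> simp
      · rw [if_neg ht, zero_mul]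
        refine Finset.sum_nonneg fun f _ => ?_
        split_ifs
        · exact Finset.prod_nonneg fun a _ => pow_nonneg hx _
        · exact le_rfl
    calc weight N k m x ^ (r + 1) = weight N k m x * weight N k m x ^ r := pow_succ' _ _
      _ ≤ (∑ t : Circ N k, if Disjoint t.verts W then x ^ t.len else 0) * weight N k m x ^ r := by
          refine mul_le_mul_of_nonneg_right ?_ (pow_nonneg (weight_nonneg m hx) r)
          rw [sum_pow_len]
          exact weight_le_weight (by omega) hx
      _ ≤ _ := by
          rw [Finset.sum_mul]
          exact Finset.sum_le_sum fun t _ => hterm t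

/-- The total number of edges of a family of patterns. -/
def totalLen {r : ℕ} (f : Fin r → Circ N k) : ℕ := ∑ a, (f a).len

theorem totalLen_le {r : ℕ} (f : Fin r → Circ N k) : totalLen f ≤ k * r := by
  calc totalLen f ≤ ∑ _a : Fin r, k := Finset.sum_le_sum fun a _ => (f a).len_le
    _ = _ := by simp [mul_comm]

open Classical in
/-- The probability that a vertex-disjoint family of circuits is present. -/
theorem card_filter_occ {r : ℕ} {f : Fin r → Circ N k} (hf : PairDisj f) :
    (Finset.univ.filter fun ω : Omega N => ∀ a, (f a).Occ ω).card *
      ∏ j ∈ Finset.range (totalLen f), (6 * N - 1 - 2 * j) = Fintype.card (Omega N) := by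
  let ι := Σ a : Fin r, Fin ((f a).1 + 1)
  let out : ι → Side N := fun i => (f i.1).2.1.outSide i.2
  let inn : ι → Side N := fun i => (f i.1).2.1.innSide (i.2 + 1)
  -- the circuits are disjoint, so that the vertex determines the place in the family
  have hvert {i j : ι} (h : (f i.1).2.1.vertex i.2 = (f j.1).2.1.vertex j.2) : i = j := by
    obtain ⟨a, i⟩ := i
    obtain ⟨b, j⟩ := j
    by_cases hab : a = b
    · subst hab
      exact congrArg _ ((f a).2.1.vertex_injective h)
    · exfalso
      refine Finset.disjoint_left.1 (hf hab) ((f a).2.1.vertex_mem i) ?_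
      change (f a).2.1.vertex i = (f b).2.1.vertex j at h
      rw [h]
      exact (f b).2.1.vertex_mem j
  have hinj : Function.Injective (Sum.elim out inn) := by
    rintro (i | i) (j | j) h
    · exact congrArg Sum.inl (hvert (congrArg Prod.fst h))
    · exfalso
      have h1 : i = ⟨j.1, j.2 + 1⟩ := hvert (congrArg Prod.fst h)
      subst h1
      exact (f j.1).2.1.inn_ne_out _ (congrArg Prod.snd h).symm
    · exfalso
      have h1 : j = ⟨i.1, i.2 + 1⟩ := hvert (congrArg Prod.fst h).symm
      subst h1
      exact (f i.1).2.1.inn_ne_out _ (congrArg Prod.snd h)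
    · have h1 : (⟨i.1, i.2 + 1⟩ : ι) = ⟨j.1, j.2 + 1⟩ := hvert (congrArg Prod.fst h)
      obtain ⟨a, i⟩ := i
      obtain ⟨b, j⟩ := j
      simp only [Sigma.mk.injEq] at h1
      obtain ⟨rfl, h2⟩ := h1
      rw [add_right_cancel (eq_of_heq h2)]
  have key := card_filter_mate_eq out inn hinj Finset.univ
  have hcard : (Finset.univ : Finset ι).card = totalLen f := by
    rw [Finset.card_univ, Fintype.card_sigma]
    simp [totalLen, len]
  rw [hcard] at key
  rw [← key]
  congr 2
  ext ω
  simp only [Finset.mem_filter, Finset.mem_univ, true_and, true_imp_iff]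
  exact ⟨fun h i => h i.1 i.2, fun h a i => h ⟨a, i⟩⟩

open Classical in
theorem expect_occ_le {r : ℕ} {f : Fin r → Circ N k} (hf : PairDisj f) (hN : 2 * (k * r) < 6 * N) :
    expect (fun ω : Omega N => if ∀ a, (f a).Occ ω then (1 : ℝ) else 0) ≤
      ∏ a, ((6 * N - 2 * (k * r) : ℝ)⁻¹) ^ (f a).len := by
  have h1 := card_filter_occ hf
  have h2 : (6 * N - 2 * (k * r) : ℝ) ^ totalLen f ≤
      ∏ j ∈ Finset.range (totalLen f), ((6 * N - 1 - 2 * j : ℕ) : ℝ) := by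
    have hpos : (0 : ℝ) ≤ 6 * N - 2 * (k * r) := by
      have : (2 * (k * r) : ℝ) ≤ 6 * N := by exact_mod_cast hN.le
      linarith
    conv_lhs => rw [← Finset.card_range (totalLen f), ← Finset.prod_const]
    refine Finset.prod_le_prod (fun j _ => hpos) fun j hj => ?_
    have h3 := Finset.mem_range.1 hj
    have h4 := totalLen_le f
    rw [sub_le_iff_le_add]
    exact_mod_cast (by omega : 6 * N ≤ (6 * N - 1 - 2 * j) + 2 * (k * r))
  have hpos : (0 : ℝ) < 6 * N - 2 * (k * r) := by
    have : (2 * (k * r) : ℝ) < 6 * N := by exact_mod_cast hN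
    linarith
  rw [Finset.prod_pow_eq_pow_sum, inv_pow, expect, Finset.sum_boole]
  rw [div_le_iff₀ card_Omega_pos, ← h1, inv_mul_eq_div, le_div_iff₀ (by positivity)]
  push_cast
  exact mul_le_mul_of_nonneg_left (by simpa [totalLen] using h2) (Nat.cast_nonneg _)

open Classical in
theorem le_expect_occ {r : ℕ} {f : Fin r → Circ N k} (hf : PairDisj f) (hN : 2 * (k * r) < 6 * N) :
    ∏ a, ((6 * N : ℝ)⁻¹) ^ (f a).len ≤
      expect (fun ω : Omega N => if ∀ a, (f a).Occ ω then (1 : ℝ) else 0) := by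
  have h1 := card_filter_occ hf
  have h2 : ∏ j ∈ Finset.range (totalLen f), ((6 * N - 1 - 2 * j : ℕ) : ℝ) ≤
      (6 * N : ℝ) ^ totalLen f := by
    conv_rhs => rw [← Finset.card_range (totalLen f), ← Finset.prod_const]
    refine Finset.prod_le_prod (fun j _ => Nat.cast_nonneg _) fun j hj => ?_
    exact_mod_cast (by omega : (6 * N - 1 - 2 * j) ≤ 6 * N)
  have hpos : (0 : ℝ) < 6 * N := by exact_mod_cast (by omega : 0 < 6 * N)
  rw [Finset.prod_pow_eq_pow_sum, inv_pow, expect, Finset.sum_boole]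
  rw [le_div_iff₀ card_Omega_pos, ← h1, inv_mul_eq_div, div_le_iff₀ (by positivity)]
  push_cast
  exact mul_le_mul_of_nonneg_left (by simpa [totalLen] using h2) (Nat.cast_nonneg _)

end Circ

namespace Circ

variable {k : ℕ}

/-- The number of circuits with at most `k` edges that turn to both sides. -/
def count (ω : Omega N) (k : ℕ) : ℕ := Nat.card {t : Circ N k // t.Occ ω}

open Classical in
/-- The number of vertex-disjoint families of `r` such circuits. -/
def disjCount (ω : Omega N) (k r : ℕ) : ℕ :=
  (Finset.univ.filter fun f : Fin r → Circ N k => PairDisj f ∧ ∀ a, (f a).Occ ω).card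

theorem PairDisj.injective {r : ℕ} {f : Fin r → Circ N k} (hf : PairDisj f) :
    Function.Injective f := by
  intro a b hab
  by_contra hne
  have h1 := hf hne
  simp only [hab, disjoint_self, Finset.bot_eq_empty] at h1
  exact (f b).verts_nonempty.ne_empty h1

open Classical in
theorem descFactorial_count (ω : Omega N) (r : ℕ) : (count ω k).descFactorial r =
    (Finset.univ.filter fun f : Fin r → Circ N k =>
      Function.Injective f ∧ ∀ a, (f a).Occ ω).card := by
  rw [count, Nat.card_eq_fintype_card]
  have h := Fintype.card_embedding_eq (α := Fin r) (β := {t : Circ N k // t.Occ ω})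
  rw [Fintype.card_fin] at h
  rw [← h, ← Fintype.card_subtype]
  refine Fintype.card_congr ⟨fun e => ⟨fun a => (e a).1, fun _ _ h => e.injective (Subtype.ext h),
    fun a => (e a).2⟩, fun f => ⟨fun a => ⟨f.1 a, f.2.2 a⟩,
    fun _ _ h => f.2.1 (congrArg Subtype.val h)⟩, fun _ => rfl, fun _ => rfl⟩

theorem disjCount_le (ω : Omega N) (r : ℕ) :
    disjCount ω k r ≤ (count ω k).descFactorial r := by
  classical
  rw [descFactorial_count]
  exact Finset.card_le_card fun f hf => by
    have := (Finset.mem_filter.1 hf).2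
    exact Finset.mem_filter.2 ⟨Finset.mem_univ _, this.1.injective, this.2⟩

/-- The vertices of a family of patterns. -/
def allVerts {r : ℕ} (f : Fin r → Circ N k) : Finset (Fin (2 * N)) :=
  Finset.univ.biUnion fun a => (f a).verts

theorem verts_subset_allVerts {r : ℕ} (f : Fin r → Circ N k) (a : Fin r) :
    (f a).verts ⊆ allVerts f :=
  Finset.subset_biUnion_of_mem (fun a => (f a).verts) (Finset.mem_univ a)

theorem card_allVerts_le {r : ℕ} (f : Fin r → Circ N k) : (allVerts f).card ≤ k * r := by
  calc (allVerts f).card ≤ ∑ a, (f a).verts.card := Finset.card_biUnion_le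
    _ = totalLen f := Finset.sum_congr rfl fun a _ => (f a).card_verts
    _ ≤ k * r := totalLen_le f

/-- Different circuits that are not all disjoint span a tight set. -/
theorem allVerts_mem_tightSets {ω : Omega N} {r : ℕ} {f : Fin r → Circ N k}
    (hf : Function.Injective f) (ho : ∀ a, (f a).Occ ω) (hd : ¬PairDisj f) :
    allVerts f ∈ tightSets ω (k * r) := by
  have hle := card_allVerts_le f
  have hu : ∀ x s s', (x, s) ∈ outgoing ω (allVerts f) → (x, s') ∈ outgoing ω (allVerts f) →
      s = s' := by
    intro x s s' hs hs'
    obtain ⟨a, -, hx⟩ := Finset.mem_biUnion.1 (Finset.mem_filter.1 hs).2.1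
    obtain ⟨i, rfl⟩ := Pattern.mem_vertices.1 hx
    rw [(ho a).eq_third_of_mem_outgoing (verts_subset_allVerts f a) hs,
      (ho a).eq_third_of_mem_outgoing (verts_subset_allVerts f a) hs']
  simp only [PairDisj, Pairwise, not_forall] at hd
  obtain ⟨a, b, hab, hd⟩ := hd
  have hex : ¬∀ i i', (f a).2.1.vertex i = (f b).2.1.vertex i' →
      (f a).2.1.third i = (f b).2.1.third i' :=
    fun ht => hab (hf (eq_of_third_eq (ho a) (ho b) ht hd))
  push Not at hex
  obtain ⟨i, i', hv, ht⟩ := hex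
  have hlt := cut_lt_card hu (verts_subset_allVerts f a ((f a).2.1.vertex_mem i)) fun s hs => ht (by
    rw [← (ho a).eq_third_of_mem_outgoing (verts_subset_allVerts f a) hs]
    rw [hv] at hs
    exact (ho b).eq_third_of_mem_outgoing (verts_subset_allVerts f b) hs)
  exact Finset.mem_filter.2 ⟨Finset.mem_univ _, by omega, hlt, by omega⟩

open Classical in
theorem card_filter_subset_le {d : ℕ} {U : Finset (Fin (2 * N))} (hU : U.card ≤ d) :
    ((Finset.univ.filter fun t : Circ N k => t.verts ⊆ U).card : ℝ) ≤
      ∑ n ∈ Finset.range k, (d : ℝ) ^ (n + 1) * 3 ^ (n + 1) * intensity n := by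
  have h1 := sum_pow_len (k := k) Uᶜ 1
  simp only [one_pow, Finset.sum_boole, disjoint_compl_right_iff] at h1
  refine (le_of_eq h1).trans (Finset.sum_le_sum fun n _ => ?_)
  have h2 : 2 * N - Uᶜ.card = U.card := by
    have h3 := Finset.card_le_univ U
    rw [Fintype.card_fin] at h3
    rw [Finset.card_compl, Fintype.card_fin]
    omega
  have h4 : (U.card.descFactorial (n + 1) : ℝ) ≤ (d : ℝ) ^ (n + 1) := by
    exact_mod_cast (Nat.descFactorial_le_pow _ _).trans (Nat.pow_le_pow_left hU _)
  have := intensity_nonneg n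
  rw [h2, mul_one]
  gcongr

/-- Up to a constant multiple of the number of tight sets, a factorial moment only counts disjoint
families. -/
theorem descFactorial_count_le (k r : ℕ) : ∃ K : ℝ, 0 ≤ K ∧ ∀ (N : ℕ) (ω : Omega N),
    ((count ω k).descFactorial r : ℝ) ≤ disjCount ω k r + K * (tightSets ω (k * r)).card := by
  classical
  set K := ∑ n ∈ Finset.range k, ((k * r : ℕ) : ℝ) ^ (n + 1) * 3 ^ (n + 1) * intensity n with hK
  have hK0 : 0 ≤ K := Finset.sum_nonneg fun n _ => mul_nonneg (by positivity) (intensity_nonneg n)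
  refine ⟨K ^ r, by positivity, fun N ω => ?_⟩
  set T := (tightSets ω (k * r)).filter fun U => U.card ≤ k * r
  have h1 : (count ω k).descFactorial r ≤ disjCount ω k r + ∑ U ∈ T,
      (Finset.univ.filter fun f : Fin r → Circ N k => ∀ a, (f a).verts ⊆ U).card := by
    rw [descFactorial_count, disjCount]
    refine le_trans (Finset.card_le_card (t := (Finset.univ.filter fun f : Fin r → Circ N k =>
      PairDisj f ∧ ∀ a, (f a).Occ ω) ∪ T.biUnion fun U =>
        Finset.univ.filter fun f : Fin r → Circ N k => ∀ a, (f a).verts ⊆ U) ?_)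
      ((Finset.card_union_le _ _).trans (Nat.add_le_add_left Finset.card_biUnion_le _))
    intro f hf
    obtain ⟨h2, h3⟩ := (Finset.mem_filter.1 hf).2
    by_cases hd : PairDisj f
    · exact Finset.mem_union_left _ (Finset.mem_filter.2 ⟨Finset.mem_univ _, hd, h3⟩)
    · refine Finset.mem_union_right _ (Finset.mem_biUnion.2 ⟨allVerts f, ?_, ?_⟩)
      · exact Finset.mem_filter.2 ⟨allVerts_mem_tightSets h2 h3 hd, card_allVerts_le f⟩
      · exact Finset.mem_filter.2 ⟨Finset.mem_univ _, verts_subset_allVerts f⟩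
  have h2 : ∀ U ∈ T, ((Finset.univ.filter fun f : Fin r → Circ N k =>
      ∀ a, (f a).verts ⊆ U).card : ℝ) ≤ K ^ r := by
    intro U hU
    have h3 : (Finset.univ.filter fun f : Fin r → Circ N k => ∀ a, (f a).verts ⊆ U) =
        Fintype.piFinset fun _ => Finset.univ.filter fun t : Circ N k => t.verts ⊆ U := by
      ext f
      simp
    rw [h3, Fintype.card_piFinset, Finset.prod_const, Finset.card_univ, Fintype.card_fin]
    push_cast
    exact pow_le_pow_left₀ (Nat.cast_nonneg _) (card_filter_subset_le (Finset.mem_filter.1 hU).2) r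
  calc ((count ω k).descFactorial r : ℝ)
      ≤ disjCount ω k r + ∑ U ∈ T, ((Finset.univ.filter fun f : Fin r → Circ N k =>
        ∀ a, (f a).verts ⊆ U).card : ℝ) := by exact_mod_cast h1
    _ ≤ disjCount ω k r + ∑ U ∈ T, K ^ r := by
        have := Finset.sum_le_sum h2
        linarith
    _ ≤ _ := by
        rw [Finset.sum_const, nsmul_eq_mul, mul_comm]
        have h4 : (T.card : ℝ) ≤ (tightSets ω (k * r)).card := by
          exact_mod_cast Finset.card_le_card (Finset.filter_subset _ _)
        have h5 := mul_le_mul_of_nonneg_left h4 (pow_nonneg hK0 r)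
        linarith

open Classical in
theorem expect_disjCount (k r : ℕ) : expect (fun ω : Omega N => (disjCount ω k r : ℝ)) =
    ∑ f : Fin r → Circ N k, if PairDisj f then
      expect (fun ω : Omega N => if ∀ a, (f a).Occ ω then (1 : ℝ) else 0) else 0 := by
  have h (ω : Omega N) : (disjCount ω k r : ℝ) = ∑ f : Fin r → Circ N k,
      if PairDisj f then (if ∀ a, (f a).Occ ω then (1 : ℝ) else 0) else 0 := by
    simp only [← ite_and]
    rw [Finset.sum_boole]
    rfl
  simp only [h]
  rw [expect_sum]
  refine Finset.sum_congr rfl fun f _ => ?_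
  split_ifs
  · rfl
  · simp [expect]

theorem expect_disjCount_le {r : ℕ} (hN : 2 * (k * r) < 6 * N) :
    expect (fun ω : Omega N => (disjCount ω k r : ℝ)) ≤
      weight N k 0 (6 * N - 2 * (k * r) : ℝ)⁻¹ ^ r := by
  classical
  have hpos : (0 : ℝ) < 6 * N - 2 * (k * r) := by
    have : (2 * (k * r) : ℝ) < 6 * N := by exact_mod_cast hN
    linarith
  have h1 := sum_pow_len (N := N) (k := k) ∅ (6 * N - 2 * (k * r) : ℝ)⁻¹
  simp only [Finset.disjoint_empty_right, if_true, Finset.card_empty] at h1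
  rw [expect_disjCount, ← h1, Fintype.sum_pow]
  refine Finset.sum_le_sum fun f _ => ?_
  split_ifs with hf
  · exact expect_occ_le hf hN
  · exact Finset.prod_nonneg fun a _ => pow_nonneg (inv_nonneg.2 hpos.le) _

theorem le_expect_disjCount {r : ℕ} (hN : 2 * (k * r) < 6 * N) :
    weight N k (k * r) (6 * N : ℝ)⁻¹ ^ r ≤
      expect (fun ω : Omega N => (disjCount ω k r : ℝ)) := by
  classical
  refine (pow_weight_le_sum (inv_nonneg.2 (by positivity)) ∅ (by simp)).trans ?_
  rw [expect_disjCount]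
  refine Finset.sum_le_sum fun f _ => ?_
  by_cases hf : PairDisj f
  · simpa [hf] using le_expect_occ hf hN
  · simp [hf]

theorem tendsto_sub_mul (a : ℕ) (c : ℝ) :
    Tendsto (fun N : ℕ => ((2 * N - a : ℕ) : ℝ) * (3 * (6 * N - c)⁻¹)) atTop (𝓝 1) := by
  have h0 : Tendsto (fun N : ℕ => (6 * N - c : ℝ)) atTop atTop :=
    tendsto_atTop_add_const_right _ _
      (tendsto_natCast_atTop_atTop.const_mul_atTop (by norm_num : (0 : ℝ) < 6))
  have h1 : Tendsto (fun N : ℕ => 1 + (c - 3 * a) * (6 * N - c : ℝ)⁻¹) atTop (𝓝 1) := by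
    simpa using (h0.inv_tendsto_atTop.const_mul (c - 3 * a)).const_add 1
  refine h1.congr' ?_
  filter_upwards [h0.eventually_gt_atTop 0, eventually_ge_atTop a] with N hN hNa
  rw [Nat.cast_sub (by omega)]
  push_cast
  field_simp
  ring

theorem tendsto_weight (k m : ℕ) (c : ℝ) :
    Tendsto (fun N : ℕ => weight N k m (6 * N - c : ℝ)⁻¹) atTop
      (𝓝 (∑ n ∈ Finset.range k, intensity n)) := by
  refine tendsto_finsetSum _ fun n _ => ?_
  have h (N : ℕ) : ((2 * N - m).descFactorial (n + 1) : ℝ) * (3 * (6 * N - c : ℝ)⁻¹) ^ (n + 1) =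
      ∏ i ∈ Finset.range (n + 1), ((2 * N - (m + i) : ℕ) : ℝ) * (3 * (6 * N - c)⁻¹) := by
    rw [Nat.descFactorial_eq_prod_range, Finset.prod_mul_distrib, Finset.prod_const,
      Finset.card_range]
    push_cast [Nat.sub_sub]
    rfl
  simp only [h]
  have h1 := (tendsto_finsetProd (Finset.range (n + 1)) fun i _ =>
    tendsto_sub_mul (m + i) c).mul_const (intensity n)
  simpa using h1

/-- The factorial moments of the number of circuits converge to those of a Poisson variable. -/
theorem tendsto_expect_descFactorial_count (k r : ℕ) :
    Tendsto (fun N : ℕ => expect fun ω : Omega N => ((count ω k).descFactorial r : ℝ)) atTop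
      (𝓝 ((∑ n ∈ Finset.range k, intensity n) ^ r)) := by
  obtain ⟨K, hK, hcount⟩ := descFactorial_count_le k r
  obtain ⟨C, hC⟩ := exists_expect_tightSets_le (k * r)
  have h1 := (tendsto_weight k (k * r) 0).pow r
  have h2 := ((tendsto_weight k 0 (2 * (k * r))).pow r).add
    ((tendsto_const_div_atTop_nhds_zero_nat C).const_mul K)
  rw [mul_zero, add_zero] at h2
  refine tendsto_of_tendsto_of_tendsto_of_le_of_le' h1 h2 ?_ ?_
  · filter_upwards [eventually_ge_atTop (3 * (k * r) + 1)] with N hN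
    rw [sub_zero]
    exact (le_expect_disjCount (by omega)).trans
      (expect_mono fun ω => by exact_mod_cast disjCount_le ω r)
  · filter_upwards [eventually_ge_atTop (3 * (k * r) + 1)] with N hN
    refine (expect_mono (hcount N)).trans ?_
    rw [expect_add, expect_const_mul]
    exact add_le_add (expect_disjCount_le (by omega)) (mul_le_mul_of_nonneg_left (hC N hN) hK)

end Circ

/-! ### Convergence to the Poisson distribution -/

/-- The partial alternating sums of a row of Pascal's triangle. -/
theorem alternating_sum_choose (x R : ℕ) :
    ∑ s ∈ Finset.range (R + 1), (-1 : ℝ) ^ s * (x + 1).choose s = (-1) ^ R * x.choose R := by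
  induction R with
  | zero => simp
  | succ R ih =>
    rw [Finset.sum_range_succ, ih, Nat.choose_succ_succ]
    push_cast
    ring

/-- Bonferroni's inequalities. -/
theorem abs_indicator_sub_sum_le (x R : ℕ) :
    |(if x = 0 then (1 : ℝ) else 0) - ∑ s ∈ Finset.range R, (-1) ^ s * (x.choose s : ℝ)| ≤
      x.choose R := by
  cases x with
  | zero =>
    cases R with
    | zero => simp
    | succ R =>
      rw [Finset.sum_range_succ']
      simp
  | succ x =>
    cases R with
    | zero => simp
    | succ R =>
      rw [alternating_sum_choose, Nat.choose_succ_succ]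
      simp [abs_mul]

/-- A sequence of random variables with values in `ℕ` whose factorial moments converge to those of a
Poisson variable vanishes with asymptotically the same probability as the Poisson variable. -/
theorem tendsto_prob_eq_zero {X : ∀ N : ℕ, Omega N → ℕ} {l : ℝ}
    (h : ∀ r, Tendsto (fun N => expect fun ω : Omega N => ((X N ω).descFactorial r : ℝ)) atTop
      (𝓝 (l ^ r))) :
    Tendsto (fun N => prob N {ω | X N ω = 0}) atTop (𝓝 (Real.exp (-l))) := by
  classical
  have hch (r : ℕ) : Tendsto (fun N => expect fun ω : Omega N => ((X N ω).choose r : ℝ)) atTop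
      (𝓝 (l ^ r / r.factorial)) := by
    refine ((h r).div_const (r.factorial : ℝ)).congr fun N => ?_
    rw [div_eq_inv_mul, ← expect_const_mul]
    congr 1
    ext ω
    rw [Nat.descFactorial_eq_factorial_mul_choose]
    push_cast
    rw [inv_mul_cancel_left₀ (by positivity)]
  have hexp : Tendsto (fun R : ℕ => |∑ s ∈ Finset.range R, (-1) ^ s * (l ^ s / s.factorial) -
      Real.exp (-l)| + l ^ R / R.factorial) atTop (𝓝 0) := by
    have h1 : HasSum (fun s : ℕ => (-1) ^ s * (l ^ s / s.factorial)) (Real.exp (-l)) := by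
      have := NormedSpace.expSeries_div_hasSum_exp (-l)
      rw [← Real.exp_eq_exp_ℝ] at this
      refine this.congr_fun fun s => ?_
      rw [neg_pow l, mul_div_assoc]
    have h2 := (h1.tendsto_sum_nat.sub_const (Real.exp (-l))).abs
    rw [sub_self, abs_zero] at h2
    simpa using h2.add (FloorSemiring.tendsto_pow_div_factorial_atTop l)
  rw [Metric.tendsto_atTop']
  intro ε hε
  -- truncate at an order `R` for which both the main term and the error term are good enough
  obtain ⟨R, hR⟩ := (hexp.eventually_lt_const hε).exists
  have hlim : Tendsto (fun N => |∑ s ∈ Finset.range R, (-1) ^ s *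
      (expect fun ω : Omega N => ((X N ω).choose s : ℝ)) - Real.exp (-l)| +
      expect fun ω : Omega N => ((X N ω).choose R : ℝ)) atTop
      (𝓝 (|∑ s ∈ Finset.range R, (-1) ^ s * (l ^ s / s.factorial) - Real.exp (-l)| +
        l ^ R / R.factorial)) :=
    ((tendsto_finsetSum _ fun s _ => (hch s).const_mul _).sub_const _).abs.add (hch R)
  obtain ⟨N₀, hN₀⟩ := eventually_atTop.1 (hlim.eventually_lt_const hR)
  refine ⟨N₀, fun N hN => lt_of_le_of_lt ?_ (hN₀ N hN.le)⟩
  have hb : |prob N {ω | X N ω = 0} - ∑ s ∈ Finset.range R, (-1) ^ s *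
      (expect fun ω : Omega N => ((X N ω).choose s : ℝ))| ≤
      expect fun ω : Omega N => ((X N ω).choose R : ℝ) := by
    have h1 : prob N {ω | X N ω = 0} - ∑ s ∈ Finset.range R, (-1) ^ s *
        (expect fun ω : Omega N => ((X N ω).choose s : ℝ)) =
        expect fun ω : Omega N => (if X N ω = 0 then (1 : ℝ) else 0) -
          ∑ s ∈ Finset.range R, (-1) ^ s * ((X N ω).choose s : ℝ) := by
      simp only [sub_eq_add_neg, ← Finset.sum_neg_distrib]
      rw [expect_add, expect_sum, prob_eq_expect]
      refine congrArg₂ _ (congrArg expect (funext fun ω => ?_)) (Finset.sum_congr rfl fun s _ => ?_)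
      · by_cases h0 : X N ω = 0 <;> simp [h0]
      simp only [← neg_mul]
      rw [expect_const_mul]
    rw [h1, expect, abs_div, abs_of_pos card_Omega_pos]
    refine div_le_div_of_nonneg_right ?_ card_Omega_pos.le
    exact (Finset.abs_sum_le_sum_abs _ _).trans
      (Finset.sum_le_sum fun ω _ => abs_indicator_sub_sum_le _ _)
  rw [Real.dist_eq]
  have := abs_sub_le (prob N {ω | X N ω = 0}) (∑ s ∈ Finset.range R, (-1) ^ s *
      (expect fun ω : Omega N => ((X N ω).choose s : ℝ))) (Real.exp (-l))
  linarith

/-- The probability that there is no circuit with at most `k` edges that turns to both sides. -/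
theorem tendsto_prob_count_eq_zero (k : ℕ) :
    Tendsto (fun N => prob N {ω | Circ.count ω k = 0}) atTop
      (𝓝 (Real.exp (-∑ n ∈ Finset.range k, intensity n))) :=
  tendsto_prob_eq_zero fun r => Circ.tendsto_expect_descFactorial_count k r

/-! ### The genus -/

/-- The corner of the triangulation at which the side `s` starts. -/
def cornerPoint (ω : Omega N) (s : Side N) : Surface ω := Surface.point ω s.1 (corner s.2)

/-- Turning around the starting corner of a side. -/
def nextSide (ω : Omega N) (s : Side N) : Side N := ((ω.mate s).1, (ω.mate s).2 + 1)

theorem cornerPoint_nextSide (ω : Omega N) (s : Side N) :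
    cornerPoint ω (nextSide ω s) = cornerPoint ω s := by
  have h := point_mate ω s 0
  rw [sidePoint_zero, unitInterval.symm_zero, sidePoint_one] at h
  exact h.symm

theorem exists_nextSide_eq (ω : Omega N) (s : Side N) :
    ∃ s', ω.mate s' = (s.1, s.2 - 1) ∧ nextSide ω s' = s := by
  refine ⟨ω.mate (s.1, s.2 - 1), ω.mate_mate _, ?_⟩
  rw [nextSide, ω.mate_mate]
  exact Prod.ext rfl (sub_add_cancel _ _)

open Classical in
/-- The triangles at a corner of the triangulation. -/
def star (ω : Omega N) (y : Surface ω) : Finset (Fin (2 * N)) :=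
  (Finset.univ.filter fun s => cornerPoint ω s = y).image Prod.fst

theorem mem_star {ω : Omega N} {y : Surface ω} {x : Fin (2 * N)} :
    x ∈ star ω y ↔ ∃ s, cornerPoint ω s = y ∧ s.1 = x := by
  simp [star]

/-- At each triangle of a star, two of the half-edges lead to triangles of the star. -/
theorem cut_star_le (ω : Omega N) (y : Surface ω) : cut ω (star ω y) ≤ (star ω y).card := by
  refine cut_le_card fun x r r' hr hr' => ?_
  obtain ⟨s, hs, rfl⟩ := mem_star.1 (Finset.mem_filter.1 hr).2.1
  have key (r : Fin 3) (hr : (s.1, r) ∈ outgoing ω (star ω y)) : r = s.2 + 1 := by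
    have h2 := (Finset.mem_filter.1 hr).2.2
    have h3 : r ≠ s.2 := by
      rintro rfl
      refine h2 (mem_star.2 ⟨nextSide ω s, ?_, rfl⟩)
      rw [cornerPoint_nextSide, hs]
    have h4 : r ≠ s.2 - 1 := by
      rintro rfl
      obtain ⟨s', h5, h6⟩ := exists_nextSide_eq ω s
      refine h2 (mem_star.2 ⟨s', ?_, ?_⟩)
      · rw [← cornerPoint_nextSide, h6, hs]
      · rw [← h5, ω.mate_mate]
    have : ∀ r r' : Fin 3, r ≠ r' → r ≠ r' - 1 → r = r' + 1 := by decide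
    exact this _ _ h3 h4
  rw [key r hr, key r' hr']

/-- There are at most `N / 2` corners of degree at least `12`, and the star of any other corner is a
small cyclic set. -/
theorem two_mul_ncard_corners_le (ω : Omega N) :
    2 * (Surface.corners ω).ncard ≤ N + 66 * (cyclicSets ω 11).card := by
  classical
  set I : Finset (Surface ω) := Finset.univ.image (cornerPoint ω) with hI
  have hV : (Surface.corners ω).ncard = I.card := by
    rw [← Set.ncard_coe_finset, hI, Finset.coe_image, Finset.coe_univ, Set.image_univ]
    rfl
  set deg : Surface ω → ℕ := fun y => (Finset.univ.filter fun s => cornerPoint ω s = y).card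
  -- the degrees of the corners add up to `6 N`
  have hlarge : 12 * (I.filter fun y => 12 ≤ deg y).card ≤ 6 * N := by
    have h1 : ∑ y ∈ I, deg y = 6 * N := by
      rw [← card_side, ← Finset.card_univ]
      exact (Finset.card_eq_sum_card_image (cornerPoint ω) Finset.univ).symm
    rw [← h1, mul_comm, ← smul_eq_mul]
    exact (Finset.card_nsmul_le_sum _ _ _ fun y hy => (Finset.mem_filter.1 hy).2).trans
      (Finset.sum_le_sum_of_subset (Finset.filter_subset _ _))
  have hsmall : (I.filter fun y => ¬12 ≤ deg y).card ≤ 33 * (cyclicSets ω 11).card := by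
    calc (I.filter fun y => ¬12 ≤ deg y).card
        ≤ (((cyclicSets ω 11).biUnion sides).image (cornerPoint ω)).card := by
          refine Finset.card_le_card fun y hy => ?_
          obtain ⟨hy1, hy2⟩ := Finset.mem_filter.1 hy
          obtain ⟨s, -, hs⟩ := Finset.mem_image.1 hy1
          refine Finset.mem_image.2 ⟨s, Finset.mem_biUnion.2 ⟨star ω y, ?_, ?_⟩, hs⟩
          · refine Finset.mem_filter.2 ⟨Finset.mem_univ _, ?_, cut_star_le ω y⟩
            have : (star ω y).card ≤ deg y := Finset.card_image_le
            omega
          · rw [mem_sides]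
            exact mem_star.2 ⟨s, hs, rfl⟩
      _ ≤ ∑ A ∈ cyclicSets ω 11, (sides A).card :=
          Finset.card_image_le.trans Finset.card_biUnion_le
      _ ≤ ∑ A ∈ cyclicSets ω 11, 33 := by
          refine Finset.sum_le_sum fun A hA => ?_
          have := (Finset.mem_filter.1 hA).2.1
          rw [card_sides]
          omega
      _ = 33 * (cyclicSets ω 11).card := by rw [Finset.sum_const, smul_eq_mul, mul_comm]
  have hsplit := Finset.card_filter_add_card_filter_not (s := I) (fun y => 12 ≤ deg y)
  rw [hV]
  omega

theorem one_le_card_connectedComponents (ω : Omega N) (hN : 0 < N) :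
    1 ≤ Nat.card (ConnectedComponents (Surface ω)) := by
  have hsurj : Function.Surjective fun i : Fin (2 * N) =>
      (vertexPoint ω i : ConnectedComponents (Surface ω)) := by
    intro y
    obtain ⟨y, rfl⟩ := ConnectedComponents.surjective_coe y
    obtain ⟨⟨i, x⟩, rfl⟩ := Quot.exists_rep y
    refine ⟨i, ConnectedComponents.coe_eq_coe'.2 (pathComponent_subset_component _ ?_)⟩
    exact ⟨(spoke ω i x).symm⟩
  have : Finite (ConnectedComponents (Surface ω)) := Finite.of_surjective _ hsurj
  have : Nonempty (ConnectedComponents (Surface ω)) := ⟨(vertexPoint ω ⟨0, by omega⟩ : _)⟩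
  exact Nat.card_pos

theorem genus_pos {ω : Omega N} (hN : 0 < N) (h : (Surface.corners ω).ncard ≤ N) :
    0 < genus ω := by
  have h1 := one_le_card_connectedComponents ω hN
  unfold genus eulerChar
  omega

/-- The genus is positive with high probability. -/
theorem tendsto_prob_genus_nonpos :
    Tendsto (fun N => prob N {ω | ¬0 < genus ω}) atTop (𝓝 0) := by
  obtain ⟨C, hC⟩ := exists_expect_cyclicSets_le 11
  have hlim := (tendsto_const_div_atTop_nhds_zero_nat C).const_mul 66
  rw [mul_zero] at hlim
  refine squeeze_zero' (Eventually.of_forall fun N => prob_nonneg _) ?_ hlim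
  filter_upwards [eventually_ge_atTop 11] with N hN
  have hN0 : (0 : ℝ) < N := by exact_mod_cast (by omega : 0 < N)
  calc prob N {ω | ¬0 < genus ω}
      ≤ expect fun ω : Omega N => 66 / N * ((cyclicSets ω 11).card : ℝ) := by
        refine prob_le_expect (fun ω => by positivity) fun ω hω => ?_
        have h1 : N < (Surface.corners ω).ncard := by
          by_contra h
          exact hω (genus_pos (by omega) (not_lt.1 h))
        have h2 := two_mul_ncard_corners_le ω
        have h3 : (N : ℝ) ≤ 66 * (cyclicSets ω 11).card := by
          exact_mod_cast (by omega : N ≤ 66 * (cyclicSets ω 11).card)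
        rw [div_mul_eq_mul_div, le_div_iff₀ hN0]
        linarith
    _ = 66 / N * expect fun ω : Omega N => ((cyclicSets ω 11).card : ℝ) := expect_const_mul _ _
    _ ≤ 66 / N * C := mul_le_mul_of_nonneg_left (hC N hN) (by positivity)
    _ = 66 * (C / N) := by ring

/-! ### The shortest non-contractible circuit -/

theorem Circ.count_eq_zero_iff {ω : Omega N} {k : ℕ} : Circ.count ω k = 0 ↔
    ∀ n < k, ∀ c : Pattern N n, c.Occurs ω → ¬c.IsMixed := by
  rw [Circ.count, Nat.card_eq_zero, or_iff_left (not_infinite_iff_finite.2 inferInstance),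
    isEmpty_subtype]
  constructor
  · intro h n hn c hc hm
    obtain ⟨c', h1, h2, h3⟩ := hc.exists_canonical hm
    exact h ⟨⟨n, hn⟩, c', h2, h3⟩ h1
  · rintro h ⟨n, c, hc⟩ ho
    exact h n n.isLt c ho hc.2

theorem Circ.count_eq_zero_mono {ω : Omega N} {k k' : ℕ} (h : k ≤ k')
    (hk : Circ.count ω k' = 0) : Circ.count ω k = 0 :=
  Circ.count_eq_zero_iff.2 fun n hn => Circ.count_eq_zero_iff.1 hk n (hn.trans_le h)

/-- The numbers of edges of the non-contractible circuits. -/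
def circuitLengths (ω : Omega N) : Set ℕ :=
  {k : ℕ | ∃ (u : Fin (2 * N)) (p : Walk ω u u), p.IsCircuit ∧ ¬p.IsContractible ∧ p.length = k}

theorem zero_notMem_circuitLengths (ω : Omega N) : 0 ∉ circuitLengths ω := by
  rintro ⟨u, p, hp, -, h0⟩
  exact hp.1 (List.length_eq_zero_iff.1 h0)

theorem not_isContractible {ω : Omega N} {k n : ℕ} (hω : tightSets ω k = ∅) {c : Pattern N n}
    (hc : c.Occurs ω) (hm : c.IsMixed) (hn : n < k) {u : Fin (2 * N)} {p : Walk ω u u}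
    (hp : p.darts = List.ofFn c.outSide) : ¬p.IsContractible := by
  intro h
  obtain ⟨⟨i, hi⟩, ⟨i', hi'⟩⟩ := hm
  obtain ⟨A, h1, h2, h3⟩ := Pattern.exists_cut_lt_card_of_isContractible hc hp h hi hi'
  have h4 : A ∈ tightSets ω k :=
    Finset.mem_filter.2 ⟨Finset.mem_univ _, by omega, h2, by omega⟩
  rw [hω] at h4
  exact Finset.notMem_empty _ h4

/-- If there are no tight sets, the short non-contractible circuits are precisely those that turn to
both sides. -/
theorem exists_circuitLengths_le_iff {ω : Omega N} {k j : ℕ} (hω : tightSets ω k = ∅)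
    (hj : j ≤ k) : (∃ m ∈ circuitLengths ω, m ≤ j) ↔ Circ.count ω j ≠ 0 := by
  rw [Ne, Circ.count_eq_zero_iff]
  push Not
  constructor
  · rintro ⟨m, ⟨u, p, hp, hc, rfl⟩, hm⟩
    obtain ⟨n, c, ho, hd⟩ := hp.exists_pattern
    have hlen : p.length = n + 1 := by simp [Walk.length, hd]
    refine ⟨n, by omega, c, ho, ?_⟩
    by_contra hmix
    refine hc ?_
    by_cases h1 : ∃ i, c.turn i = true
    · refine ho.isContractible hd (b := true) fun i => ?_
      by_contra h2
      exact hmix ⟨h1, i, by simpa using h2⟩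
    · refine ho.isContractible hd (b := false) fun i => ?_
      by_contra h2
      exact h1 ⟨i, by simpa using h2⟩
  · rintro ⟨n, hn, c, ho, hm⟩
    obtain ⟨p, hp⟩ := ho.exists_walk
    exact ⟨p.length, ⟨_, p, ho.isCircuit hp, not_isContractible hω ho hm (by omega) hp, rfl⟩,
      by simp [Walk.length, hp]; omega⟩

theorem mEll_eq_iff {ω : Omega N} {k : ℕ} (hg : 0 < genus ω) (hω : tightSets ω (k + 1) = ∅) :
    mEll ω = k + 1 ↔ Circ.count ω k = 0 ∧ Circ.count ω (k + 1) ≠ 0 := by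
  have h1 := exists_circuitLengths_le_iff hω (Nat.le_succ k)
  have h2 := exists_circuitLengths_le_iff hω le_rfl
  rw [← h2, ← not_iff_not.2 h1 |>.trans not_not, mEll, if_pos hg]
  change sInf (circuitLengths ω) = k + 1 ↔ _
  constructor
  · intro h
    have hne : (circuitLengths ω).Nonempty := by
      by_contra hne
      rw [Set.not_nonempty_iff_eq_empty] at hne
      simp [hne] at h
    refine ⟨?_, _, Nat.sInf_mem hne, h.le⟩
    rintro ⟨m, hm, hmk⟩
    have := Nat.sInf_le hm
    omega
  · rintro ⟨h3, m, hm, hmk⟩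
    push Not at h3
    have h4 : m = k + 1 := by
      have := h3 m hm
      omega
    subst h4
    refine le_antisymm (Nat.sInf_le hm) ?_
    have := h3 _ (Nat.sInf_mem ⟨_, hm⟩)
    omega

theorem count_eq_zero_of_mEll_eq_zero {ω : Omega N} {k : ℕ} (hg : 0 < genus ω)
    (hω : tightSets ω k = ∅) (h : mEll ω = 0) : Circ.count ω k = 0 := by
  by_contra hne
  obtain ⟨m, hm, -⟩ := (exists_circuitLengths_le_iff hω le_rfl).2 hne
  rw [mEll, if_pos hg] at h
  change sInf (circuitLengths ω) = 0 at h
  have h1 := Nat.sInf_mem (⟨m, hm⟩ : (circuitLengths ω).Nonempty)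
  rw [h] at h1
  exact zero_notMem_circuitLengths ω h1

/-- The exceptional event: the genus is zero or there is a tight set. -/
def exceptional (N k : ℕ) : Set (Omega N) := {ω | ¬0 < genus ω} ∪ {ω | tightSets ω k ≠ ∅}

theorem tendsto_prob_exceptional (k : ℕ) :
    Tendsto (fun N => prob N (exceptional N k)) atTop (𝓝 0) := by
  obtain ⟨C, hC⟩ := exists_expect_tightSets_le k
  have h1 := tendsto_prob_genus_nonpos.add (tendsto_const_div_atTop_nhds_zero_nat C)
  rw [add_zero] at h1
  refine squeeze_zero' (Eventually.of_forall fun N => prob_nonneg _) ?_ h1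
  filter_upwards [eventually_ge_atTop (3 * k + 1)] with N hN
  refine (prob_union_le _ _).trans (add_le_add le_rfl ?_)
  refine (prob_le_expect (fun ω => Nat.cast_nonneg _) fun ω hω => ?_).trans (hC N hN)
  exact_mod_cast Finset.card_pos.2 (Finset.nonempty_iff_ne_empty.2 hω)

theorem not_mem_exceptional {k : ℕ} {ω : Omega N} (h : ω ∉ exceptional N k) :
    0 < genus ω ∧ tightSets ω k = ∅ := by
  simpa [exceptional] using h

theorem half_mul_le_sum_intensity (k : ℕ) :
    (k : ℝ) / 2 ≤ ∑ n ∈ Finset.range (k + 1), intensity n := by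
  induction k with
  | zero => simp [intensity]
  | succ k ih =>
    rw [Finset.sum_range_succ]
    have h1 : (k + 2 : ℝ) ≤ 2 ^ (k + 1) := by exact_mod_cast (Nat.lt_two_pow_self (n := k + 1))
    have h2 : (1 / 2 : ℝ) ≤ intensity (k + 1) := by
      rw [intensity, div_le_div_iff₀ (by norm_num) (by positivity)]
      push_cast
      linarith
    push_cast
    linarith

theorem sum_range_intensity (k : ℕ) : ∑ n ∈ Finset.range k, intensity n =
    ∑ j ∈ Finset.Icc 1 k, ((2 : ℝ) ^ (j - 1) - 1) / (j : ℝ) := by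
  induction k with
  | zero => simp
  | succ k ih =>
    rw [Finset.sum_range_succ, ih, Finset.sum_Icc_succ_top (by omega), intensity]
    simp

theorem tendsto_prob_mEll_succ (k : ℕ) :
    Tendsto (fun N => prob N {ω | mEll ω = k + 1}) atTop
      (𝓝 (Real.exp (-∑ n ∈ Finset.range k, intensity n) -
        Real.exp (-∑ n ∈ Finset.range (k + 1), intensity n))) := by
  have h1 := (tendsto_prob_count_eq_zero k).sub (tendsto_prob_count_eq_zero (k + 1))
  have h2 := tendsto_prob_exceptional (k + 1)
  have h3 := h1.sub h2
  have h4 := h1.add h2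
  rw [sub_zero] at h3
  rw [add_zero] at h4
  have hdiff (N : ℕ) : prob N {ω | Circ.count ω k = 0} - prob N {ω | Circ.count ω (k + 1) = 0} =
      prob N ({ω | Circ.count ω k = 0} \ {ω | Circ.count ω (k + 1) = 0}) :=
    (prob_diff fun ω hω => Circ.count_eq_zero_mono (Nat.le_succ k) hω).symm
  refine tendsto_of_tendsto_of_tendsto_of_le_of_le h3 h4 (fun N => ?_) fun N => ?_
  · change _ - _ - _ ≤ _
    rw [hdiff, sub_le_iff_le_add]
    refine (prob_mono fun ω hω => ?_).trans (prob_union_le _ (exceptional N (k + 1)))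
    by_cases he : ω ∈ exceptional N (k + 1)
    · exact Or.inr he
    · obtain ⟨hg, ht⟩ := not_mem_exceptional he
      exact Or.inl ((mEll_eq_iff hg ht).2 hω)
  · change _ ≤ _ - _ + _
    rw [hdiff]
    refine (prob_mono fun ω hω => ?_).trans (prob_union_le _ (exceptional N (k + 1)))
    by_cases he : ω ∈ exceptional N (k + 1)
    · exact Or.inr he
    · obtain ⟨hg, ht⟩ := not_mem_exceptional he
      exact Or.inl ((mEll_eq_iff hg ht).1 hω)

theorem tendsto_prob_mEll_zero : Tendsto (fun N => prob N {ω | mEll ω = 0}) atTop (𝓝 0) := by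
  have hexp : Tendsto (fun k : ℕ => Real.exp (-((k : ℝ) / 2))) atTop (𝓝 0) :=
    Real.tendsto_exp_neg_atTop_nhds_zero.comp
      (tendsto_natCast_atTop_atTop.atTop_div_const (by norm_num))
  refine tendsto_order.2 ⟨fun a ha => Eventually.of_forall fun N => ha.trans_le (prob_nonneg _),
    fun a ha => ?_⟩
  obtain ⟨k, hk⟩ := (hexp.eventually_lt_const ha).exists
  have h1 := (tendsto_prob_exceptional (k + 1)).add (tendsto_prob_count_eq_zero (k + 1))
  rw [zero_add] at h1
  have h2 : Real.exp (-∑ n ∈ Finset.range (k + 1), intensity n) < a :=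
    (Real.exp_le_exp.2 (neg_le_neg (half_mul_le_sum_intensity k))).trans_lt hk
  filter_upwards [h1.eventually_lt_const h2] with N hN
  refine lt_of_le_of_lt ((prob_mono fun ω hω => ?_).trans (prob_union_le (exceptional N (k + 1))
    {ω | Circ.count ω (k + 1) = 0})) hN
  by_cases he : ω ∈ exceptional N (k + 1)
  · exact Or.inl he
  · obtain ⟨hg, ht⟩ := not_mem_exceptional he
    exact Or.inr (count_eq_zero_of_mEll_eq_zero hg ht hω)

end RandomSurface

end

theorem mainTheorem6 (k : ℕ) :
    Tendsto (fun N : ℕ => RandomSurface.prob N {ω | RandomSurface.mEll ω = k}) atTop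
      (𝓝 (Real.exp (-∑ j ∈ Finset.Icc 1 (k - 1), ((2 : ℝ) ^ (j - 1) - 1) / (j : ℝ)) -
        Real.exp (-∑ j ∈ Finset.Icc 1 k, ((2 : ℝ) ^ (j - 1) - 1) / (j : ℝ)))) := by
  cases k with
  | zero => simpa using RandomSurface.tendsto_prob_mEll_zero
  | succ k =>
    rw [Nat.add_sub_cancel, ← RandomSurface.sum_range_intensity k,
      ← RandomSurface.sum_range_intensity (k + 1)]
    exact RandomSurface.tendsto_prob_mEll_succ k
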